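/- Let $k$ be a field, let $\{\beta_i\}_{i\ge 0}$ and $\{\bar\gamma_i\}_{i\ge 1}$ be sequences of positive rational numbers, and let $\{\lambda_i\}_{i\ge 1}$, $\{\bar\mu_i\}_{i\ge 1}$ be sequences of nonzero elements of $k$. Put $G_i=\sum_{j=0}^{i}\beta_j\mathbb{Z}$, $G=\bigcup_i G_i$, $\bar H_i=\sum_{j=1}^{i}\bar\gamma_j\mathbb{Z}$ (so $\bar H_0=0$), $\bar m_0=0$, and for $i\ge 1$ $$q_i=\min\{q\in\mathbb{Z}_{>0}\mid q\beta_i\in G_{i-1}\},\qquad \bar s_i=\min\{s\in\mathbb{Z}_{>0}\mid s\bar\gamma_i\in \bar H_{i-1}+G\},$$ $$\bar m_i=\max\bigl(\bar m_{i-1},\ \min\{j\ge 0\mid \bar s_i\bar\gamma_i\in \bar H_{i-1}+G_j\}\bigr).$$ For $i\ge 1$ there are unique integers $n_{i,0}$ and $0\le n_{i,j}<q_j$ ($1\le j\le i-1$) with $q_i\beta_i=\sum_{j=0}^{i-1}n_{i,j}\beta_j$, and unique integers $a_i$, $0\le\bar n_{i,j}<q_j$ ($1\le j\le \bar m_i$)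 and $0\le\bar l_{i,j}<\bar s_j$ ($1\le j\le i-1$) with $$\bar s_i\bar\gamma_i=a_i\beta_0+\sum_{j=1}^{\bar m_i}\bar n_{i,j}\beta_j+\sum_{j=1}^{i-1}\bar l_{i,j}\bar\gamma_j .$$ Put $\bar n_{i,0}=\max(0,a_i)$ and $\bar r_{i,0}=\max(0,-a_i)$. Assume that for all $i\ge 1$ $$\beta_{i+1}>q_i\beta_i,\qquad \bar\gamma_{i+1}>\bar r_{i,0}\beta_0+\bar s_i\bar\gamma_i$$ (the first condition implies $n_{i,0}>0$). Define polynomials in $k[x,y,z]$ by $P_0=x$, $P_1=y$, $Q_1=z$ and, for $i\ge 1$, $$P_{i+1}=P_i^{q_i}-\lambda_i\prod_{j=0}^{i-1}P_j^{n_{i,j}},\qquad Q_{i+1}=x^{\bar r_{i,0}}Q_i^{\bar s_i}-\bar\mu_i\prod_{j=0}^{\bar m_i}P_j^{\bar n_{i,j}}\prod_{j=1}^{i-1}Q_j^{\bar l_{i,j}} .$$ Assume that infinitely many $q_i$ are greater than $1$ and infinitely many $\bar s_i$ are greater than $1$. Then there is a unique valuation $\nu:k(x,y,z)\setminus\{0\}\to\mathbb{Q}$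 (written additively, not required to be surjective) that dominates the local ring $R=k[x,y,z]_{(x,y,z)}$, i.e. $\nu\ge 0$ on $R\setminus\{0\}$ and, for $f \in R\setminus\{0\}$, $\nu(f)>0$ if and only if $f\in m_R$, and that satisfies $\nu(P_i)=\beta_i$ for all $i\ge 0$ and $\nu(Q_i)=\bar\gamma_i$ for all $i\ge 1$. -/

import Mathlib

/-!
Defining sequences for rational rank one valuations on `k(x, y, z)`.

Sequences are indexed as follows: `β i` for `i ≥ 0`, while `γ i`, `lam i`, `mu i` are used for
`i ≥ 1` only (the entry with index `0` is never used). The variables `x, y, z` are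
`X 0, X 1, X 2` in `MvPolynomial (Fin 3) k`.
-/

namespace DefSeq

/-! ### The numerical data -/

section Numerical

/-- `G_i = β_0 ℤ + ⋯ + β_i ℤ`. -/
def G (β : ℕ → ℚ) (i : ℕ) : AddSubgroup ℚ :=
  AddSubgroup.closure (β '' Set.Iic i)

/-- `G = ⋃ G_i = ∑_{j ≥ 0} β_j ℤ`. -/
def GInf (β : ℕ → ℚ) : AddSubgroup ℚ :=
  AddSubgroup.closure (Set.range β)

/-- `H_i = γ_1 ℤ + ⋯ + γ_i ℤ`, in particular `H_0 = 0`. -/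
def H (γ : ℕ → ℚ) (i : ℕ) : AddSubgroup ℚ :=
  AddSubgroup.closure (γ '' Set.Icc 1 i)

/-- `q_i = min {q > 0 | q β_i ∈ G_{i-1}}` for `i ≥ 1`. -/
noncomputable def q (β : ℕ → ℚ) (i : ℕ) : ℕ :=
  sInf {n : ℕ | 0 < n ∧ (n : ℚ) * β i ∈ G β (i - 1)}

/-- `s_i = min {s > 0 | s γ_i ∈ H_{i-1} + G}` for `i ≥ 1`. -/
noncomputable def s (β γ : ℕ → ℚ) (i : ℕ) : ℕ :=
  sInf {n : ℕ | 0 < n ∧ (n : ℚ) * γ i ∈ H γ (i - 1) ⊔ GInf β}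

/-- `m_0 = 0` and `m_i = max (m_{i-1}, min {j ≥ 0 | s_i γ_i ∈ H_{i-1} + G_j})` for `i ≥ 1`. -/
noncomputable def m (β γ : ℕ → ℚ) : ℕ → ℕ
  | 0 => 0
  | i + 1 => max (m β γ i) (sInf {j : ℕ | (s β γ (i + 1) : ℚ) * γ (i + 1) ∈ H γ i ⊔ G β j})

/-- `α = a β_0 + ∑_{j=1}^{M} n_j β_j` with `0 ≤ n_j < q_j` for `1 ≤ j ≤ M`
(and, so that `n` is determined, `n_j = 0` for all other `j`). -/
structure IsBetaExpansion (β : ℕ → ℚ) (M : ℕ) (α : ℚ) (a : ℤ) (n : ℕ → ℕ) : Prop where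
  eq : α = a * β 0 + ∑ j ∈ Finset.Icc 1 M, (n j : ℚ) * β j
  lt : ∀ j ∈ Finset.Icc 1 M, n j < q β j
  zero : ∀ j, j ∉ Finset.Icc 1 M → n j = 0

/-- `α = a β_0 + ∑_{j=1}^{M} n_j β_j + ∑_{j=1}^{N} l_j γ_j` with `0 ≤ n_j < q_j` for `1 ≤ j ≤ M`
and `0 ≤ l_j < s_j` for `1 ≤ j ≤ N` (and `n_j = 0`, `l_j = 0` for all other `j`). -/
structure IsExpansion (β γ : ℕ → ℚ) (M N : ℕ) (α : ℚ) (a : ℤ) (n l : ℕ → ℕ) : Prop where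
  eq : α = a * β 0 + ∑ j ∈ Finset.Icc 1 M, (n j : ℚ) * β j
    + ∑ j ∈ Finset.Icc 1 N, (l j : ℚ) * γ j
  nlt : ∀ j ∈ Finset.Icc 1 M, n j < q β j
  llt : ∀ j ∈ Finset.Icc 1 N, l j < s β γ j
  nzero : ∀ j, j ∉ Finset.Icc 1 M → n j = 0
  lzero : ∀ j, j ∉ Finset.Icc 1 N → l j = 0

/-- The expansion `q_i β_i = n_{i,0} β_0 + ∑_{j=1}^{i-1} n_{i,j} β_j`, for `i ≥ 1`: the pair of
`n_{i,0} ∈ ℤ` and `j ↦ n_{i,j}` (`j ≥ 1`). It exists and is unique when `β` is positive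
(see `betaExp_spec` and `isBetaExpansion_unique` below). -/
noncomputable def betaExp (β : ℕ → ℚ) (i : ℕ) : ℤ × (ℕ → ℕ) :=
  Classical.epsilon fun t => IsBetaExpansion β (i - 1) (q β i * β i) t.1 t.2

/-- The expansion
`s_i γ_i = a_i β_0 + ∑_{j=1}^{m_i} n_{i,j} β_j + ∑_{j=1}^{i-1} l_{i,j} γ_j`, for `i ≥ 1`: the
triple of `a_i ∈ ℤ`, `j ↦ n_{i,j}` (`j ≥ 1`) and `j ↦ l_{i,j}`. It exists and is unique when `β`
is positive (see `gammaExp_spec` and `isExpansion_unique` below). -/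
noncomputable def gammaExp (β γ : ℕ → ℚ) (i : ℕ) : ℤ × (ℕ → ℕ) × (ℕ → ℕ) :=
  Classical.epsilon fun t =>
    IsExpansion β γ (m β γ i) (i - 1) (s β γ i * γ i) t.1 t.2.1 t.2.2

/-- The exponents `n_{i,j}`, `0 ≤ j ≤ i - 1`, of `P_j` in the definition of `P_{i+1}`. (The integer
`n_{i,0}` is positive under the growth condition on `β`, see `betaExp_pos` below.) -/
noncomputable def nP (β : ℕ → ℚ) (i j : ℕ) : ℕ :=
  if j = 0 then (betaExp β i).1.toNat else (betaExp β i).2 j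

/-- `r_{i,0} = max (0, -a_i)`. -/
noncomputable def r (β γ : ℕ → ℚ) (i : ℕ) : ℕ := (-(gammaExp β γ i).1).toNat

/-- The exponents of `P_j`, `0 ≤ j ≤ m_i`, in the definition of `Q_{i+1}`; the exponent of `P_0`
is `max (0, a_i)`. -/
noncomputable def nQ (β γ : ℕ → ℚ) (i j : ℕ) : ℕ :=
  if j = 0 then (gammaExp β γ i).1.toNat else (gammaExp β γ i).2.1 j

/-- The exponents `l_{i,j}`, `1 ≤ j ≤ i - 1`, of `Q_j` in the definition of `Q_{i+1}`. -/
noncomputable def lQ (β γ : ℕ → ℚ) (i j : ℕ) : ℕ := (gammaExp β γ i).2.2 j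

end Numerical

/-! ### The expansions exist and are unique -/

section Facts

variable {β γ : ℕ → ℚ}

theorem G_succ (β : ℕ → ℚ) (i : ℕ) :
    G β (i + 1) = G β i ⊔ AddSubgroup.zmultiples (β (i + 1)) := by
  have : Set.Iic (i + 1) = Set.Iic i ∪ {i + 1} := by
    ext j; simp only [Set.mem_Iic, Set.mem_union, Set.mem_singleton_iff]; omega
  rw [G, this, Set.image_union, AddSubgroup.closure_union, Set.image_singleton,
    AddSubgroup.zmultiples_eq_closure, G]

theorem H_succ (γ : ℕ → ℚ) (i : ℕ) :
    H γ (i + 1) = H γ i ⊔ AddSubgroup.zmultiples (γ (i + 1)) := by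
  have : Set.Icc 1 (i + 1) = Set.Icc 1 i ∪ {i + 1} := by
    ext j; simp only [Set.mem_Icc, Set.mem_union, Set.mem_singleton_iff]; omega
  rw [H, this, Set.image_union, AddSubgroup.closure_union, Set.image_singleton,
    AddSubgroup.zmultiples_eq_closure, H]

theorem H_zero (γ : ℕ → ℚ) : H γ 0 = ⊥ := by simp [H]

theorem mem_G_zero {x : ℚ} : x ∈ G β 0 ↔ ∃ c : ℤ, x = c * β 0 := by
  have : Set.Iic 0 = ({0} : Set ℕ) := by ext; simp
  rw [G, this, Set.image_singleton, AddSubgroup.mem_closure_singleton]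
  simp [eq_comm]

theorem mem_sup_zmultiples {A : AddSubgroup ℚ} {g x : ℚ} :
    x ∈ A ⊔ AddSubgroup.zmultiples g ↔ ∃ c : ℤ, x - c * g ∈ A := by
  rw [AddSubgroup.mem_sup]
  constructor
  · rintro ⟨y, hy, z, hz, rfl⟩
    obtain ⟨c, rfl⟩ := AddSubgroup.mem_zmultiples_iff.mp hz
    exact ⟨c, by simpa using hy⟩
  · rintro ⟨c, hc⟩
    exact ⟨_, hc, c * g, AddSubgroup.mem_zmultiples_iff.mpr ⟨c, by simp⟩, by ring⟩

theorem beta_mem_G {i j : ℕ} (h : i ≤ j) : β i ∈ G β j :=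
  AddSubgroup.subset_closure ⟨i, h, rfl⟩

theorem G_mono {i j : ℕ} (h : i ≤ j) : G β i ≤ G β j :=
  AddSubgroup.closure_mono (Set.image_mono (Set.Iic_subset_Iic.mpr h))

theorem G_le_GInf (i : ℕ) : G β i ≤ GInf β :=
  AddSubgroup.closure_mono (Set.image_subset_range _ _)

theorem exists_mem_G_of_mem_GInf {x : ℚ} (hx : x ∈ GInf β) : ∃ j, x ∈ G β j := by
  refine AddSubgroup.closure_induction ?_ ?_ ?_ ?_ hx
  · rintro _ ⟨j, rfl⟩
    exact ⟨j, beta_mem_G le_rfl⟩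
  · exact ⟨0, zero_mem _⟩
  · rintro x y _ _ ⟨i, hi⟩ ⟨j, hj⟩
    exact ⟨max i j, add_mem (G_mono (le_max_left _ _) hi) (G_mono (le_max_right _ _) hj)⟩
  · rintro x _ ⟨i, hi⟩
    exact ⟨i, neg_mem hi⟩

theorem exists_nat_mul_mem (A : AddSubgroup ℚ) {b : ℚ} (hb : b ≠ 0) (hA : b ∈ A) (x : ℚ) :
    ∃ n : ℕ, 0 < n ∧ (n : ℚ) * x ∈ A := by
  refine ⟨(x / b).den, (x / b).den_pos, ?_⟩
  have h : ((x / b).den : ℚ) * x = (x / b).num • b := by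
    have := Rat.den_mul_eq_num (x / b)
    rw [zsmul_eq_mul, ← this]
    field_simp
  rw [h]
  exact zsmul_mem hA _

theorem q_spec (h0 : β 0 ≠ 0) (i : ℕ) : 0 < q β i ∧ (q β i : ℚ) * β i ∈ G β (i - 1) :=
  Nat.sInf_mem (exists_nat_mul_mem (G β (i - 1)) h0 (beta_mem_G (Nat.zero_le _)) (β i))

theorem q_min {i n : ℕ} (hn : 0 < n) (h : (n : ℚ) * β i ∈ G β (i - 1)) : q β i ≤ n :=
  Nat.sInf_le ⟨hn, h⟩

theorem s_spec (h0 : β 0 ≠ 0) (i : ℕ) :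
    0 < s β γ i ∧ (s β γ i : ℚ) * γ i ∈ H γ (i - 1) ⊔ GInf β :=
  Nat.sInf_mem (exists_nat_mul_mem (H γ (i - 1) ⊔ GInf β) h0
    (AddSubgroup.mem_sup_right (G_le_GInf 0 (beta_mem_G le_rfl))) (γ i))

theorem s_min {i n : ℕ} (hn : 0 < n) (h : (n : ℚ) * γ i ∈ H γ (i - 1) ⊔ GInf β) :
    s β γ i ≤ n :=
  Nat.sInf_le ⟨hn, h⟩

theorem m_spec (h0 : β 0 ≠ 0) {i M : ℕ} (h : m β γ (i + 1) ≤ M) :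
    (s β γ (i + 1) : ℚ) * γ (i + 1) ∈ H γ i ⊔ G β M := by
  have hne : ∃ j : ℕ, (s β γ (i + 1) : ℚ) * γ (i + 1) ∈ H γ i ⊔ G β j := by
    obtain ⟨y, hy, z, hz, hyz⟩ := AddSubgroup.mem_sup.mp (s_spec (γ := γ) h0 (i + 1)).2
    obtain ⟨j, hj⟩ := exists_mem_G_of_mem_GInf hz
    exact ⟨j, AddSubgroup.mem_sup.mpr ⟨y, hy, z, hj, hyz⟩⟩
  have h1 : (s β γ (i + 1) : ℚ) * γ (i + 1) ∈ H γ i ⊔ G β (sInf _) := Nat.sInf_mem hne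
  rw [m] at h
  exact sup_le_sup_left (G_mono ((le_max_right _ _).trans h)) _ h1

theorem exists_digit {A : AddSubgroup ℚ} {g x : ℚ} {t : ℕ} (ht : 0 < t) (hg : (t : ℚ) * g ∈ A)
    (hx : x ∈ A ⊔ AddSubgroup.zmultiples g) : ∃ d : ℕ, d < t ∧ x - d * g ∈ A := by
  obtain ⟨c, hc⟩ := mem_sup_zmultiples.mp hx
  have ht' : (0 : ℤ) < t := by exact_mod_cast ht
  refine ⟨(c % t).toNat, by have := Int.emod_lt_of_pos c ht'; have := Int.emod_nonneg c ht'.ne'; omega, ?_⟩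
  have h1 : (((c % t).toNat : ℕ) : ℚ) = c - t * ((c / t : ℤ) : ℚ) := by
    have h2 : (((c % t).toNat : ℕ) : ℤ) = c - t * (c / t) := by
      rw [Int.toNat_of_nonneg (Int.emod_nonneg c ht'.ne'), Int.emod_def]
    exact_mod_cast h2
  have h3 : x - (((c % t).toNat : ℕ) : ℚ) * g = (x - c * g) + (c / t : ℤ) • ((t : ℚ) * g) := by
    rw [h1, zsmul_eq_mul]; ring
  rw [h3]
  exact add_mem hc (zsmul_mem hg _)

theorem digit_unique {A : AddSubgroup ℚ} {g x : ℚ} {t d e : ℕ}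
    (hmin : ∀ n : ℕ, 0 < n → (n : ℚ) * g ∈ A → t ≤ n) (hd : d < t) (he : e < t)
    (hxd : x - d * g ∈ A) (hxe : x - e * g ∈ A) : d = e := by
  wlog hde : d ≤ e generalizing d e
  · exact (this he hd hxe hxd (le_of_not_ge hde)).symm
  by_contra hne
  have := hmin (e - d) (by omega) (by
    have h := sub_mem hxd hxe
    rw [Nat.cast_sub hde]
    convert h using 1
    ring)
  omega

theorem exists_isBetaExpansion (h0 : β 0 ≠ 0) (M : ℕ) (α : ℚ) (hα : α ∈ G β M) :
    ∃ a n, IsBetaExpansion β M α a n := by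
  induction M generalizing α with
  | zero =>
    obtain ⟨c, rfl⟩ := mem_G_zero.mp hα
    exact ⟨c, 0, by simp, by simp, by simp⟩
  | succ M ih =>
    rw [G_succ] at hα
    obtain ⟨d, hd, hx⟩ := exists_digit (q_spec h0 (M + 1)).1 (q_spec h0 (M + 1)).2 hα
    obtain ⟨a, n, h⟩ := ih _ hx
    refine ⟨a, Function.update n (M + 1) d, ?_, ?_, ?_⟩
    · rw [Finset.sum_Icc_succ_top (by omega), Function.update_self, ← add_assoc]
      rw [Finset.sum_congr rfl (g := fun j => (n j : ℚ) * β j), ← h.eq]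
      · simp
      · intro j hj
        rw [Function.update_of_ne]
        have := Finset.mem_Icc.mp hj; omega
    · intro j hj
      rcases eq_or_ne j (M + 1) with rfl | hne
      · simpa using hd
      · rw [Function.update_of_ne hne]
        exact h.lt j (by rw [Finset.mem_Icc] at hj ⊢; omega)
    · intro j hj
      rw [Finset.mem_Icc] at hj
      rw [Function.update_of_ne (by omega)]
      exact h.zero j (by rw [Finset.mem_Icc]; omega)

theorem sum_beta_mem (M : ℕ) (a : ℤ) (n : ℕ → ℕ) :
    a * β 0 + ∑ j ∈ Finset.Icc 1 M, (n j : ℚ) * β j ∈ G β M := by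
  refine add_mem ?_ (sum_mem fun j hj => ?_)
  · rw [← zsmul_eq_mul]; exact zsmul_mem (beta_mem_G (Nat.zero_le _)) _
  · rw [← nsmul_eq_mul]; exact nsmul_mem (beta_mem_G (Finset.mem_Icc.mp hj).2) _

theorem isBetaExpansion_unique (h0 : β 0 ≠ 0) {M : ℕ} {α : ℚ} {a a' : ℤ} {n n' : ℕ → ℕ}
    (h : IsBetaExpansion β M α a n) (h' : IsBetaExpansion β M α a' n') : a = a' ∧ n = n' := by
  induction M generalizing α n n' with
  | zero =>
    constructor
    · have := h.eq.symm.trans h'.eq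
      simpa [h0] using this
    · funext j; rw [h.zero j (by simp), h'.zero j (by simp)]
  | succ M ih =>
    have key : ∀ {a : ℤ} {n : ℕ → ℕ}, IsBetaExpansion β (M + 1) α a n →
        α - n (M + 1) * β (M + 1) = a * β 0 + ∑ j ∈ Finset.Icc 1 M, (n j : ℚ) * β j := by
      intro a n h
      rw [h.eq, Finset.sum_Icc_succ_top (by omega)]; ring
    have hM : M + 1 ∈ Finset.Icc 1 (M + 1) := by simp
    have hd : n (M + 1) = n' (M + 1) :=
      digit_unique (A := G β M) (fun k hk hm => q_min (i := M + 1) hk hm) (h.lt _ hM)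
        (h'.lt _ hM) (key h ▸ sum_beta_mem M a n) (key h' ▸ sum_beta_mem M a' n')
    have trunc : ∀ {a : ℤ} {n : ℕ → ℕ}, IsBetaExpansion β (M + 1) α a n →
        IsBetaExpansion β M (α - n (M + 1) * β (M + 1)) a (Function.update n (M + 1) 0) := by
      intro a n h
      refine ⟨?_, ?_, ?_⟩
      · rw [key h]
        congr 1
        refine Finset.sum_congr rfl fun j hj => ?_
        rw [Function.update_of_ne]
        have := Finset.mem_Icc.mp hj; omega
      · intro j hj
        rw [Finset.mem_Icc] at hj
        rw [Function.update_of_ne (by omega)]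
        exact h.lt j (by rw [Finset.mem_Icc]; omega)
      · intro j hj
        rcases eq_or_ne j (M + 1) with rfl | hne
        · simp
        · rw [Function.update_of_ne hne]
          exact h.zero j (by rw [Finset.mem_Icc] at hj ⊢; omega)
    obtain ⟨ha, hn⟩ := ih (trunc h) (hd ▸ trunc h')
    refine ⟨ha, funext fun j => ?_⟩
    rcases eq_or_ne j (M + 1) with rfl | hne
    · exact hd
    · simpa [Function.update_of_ne hne] using congrFun hn j

theorem exists_isExpansion (h0 : β 0 ≠ 0) (M N : ℕ) (hM : m β γ N ≤ M) (α : ℚ)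
    (hα : α ∈ H γ N ⊔ G β M) : ∃ a n l, IsExpansion β γ M N α a n l := by
  induction N generalizing α with
  | zero =>
    rw [H_zero, bot_sup_eq] at hα
    obtain ⟨a, n, h⟩ := exists_isBetaExpansion h0 M α hα
    exact ⟨a, n, 0, by simpa using h.eq, h.lt, by simp, h.zero, by simp⟩
  | succ N ih =>
    rw [H_succ, sup_right_comm] at hα
    obtain ⟨d, hd, hx⟩ := exists_digit (s_spec h0 (N + 1)).1 (m_spec h0 hM) hα
    obtain ⟨a, n, l, h⟩ := ih (le_trans (le_max_left _ _) hM) _ hx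
    refine ⟨a, n, Function.update l (N + 1) d, ?_, h.nlt, ?_, h.nzero, ?_⟩
    · rw [Finset.sum_Icc_succ_top (by omega), Function.update_self, ← add_assoc]
      rw [Finset.sum_congr rfl (s₁ := Finset.Icc 1 N) (g := fun j => (l j : ℚ) * γ j), ← h.eq]
      · simp
      · intro j hj
        rw [Function.update_of_ne]
        have := Finset.mem_Icc.mp hj; omega
    · intro j hj
      rcases eq_or_ne j (N + 1) with rfl | hne
      · simpa using hd
      · rw [Function.update_of_ne hne]
        exact h.llt j (by rw [Finset.mem_Icc] at hj ⊢; omega)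
    · intro j hj
      rw [Finset.mem_Icc] at hj
      rw [Function.update_of_ne (by omega)]
      exact h.lzero j (by rw [Finset.mem_Icc]; omega)

theorem isExpansion_unique (h0 : β 0 ≠ 0) {M N : ℕ} {α : ℚ} {a a' : ℤ} {n n' l l' : ℕ → ℕ}
    (h : IsExpansion β γ M N α a n l) (h' : IsExpansion β γ M N α a' n' l') :
    a = a' ∧ n = n' ∧ l = l' := by
  induction N generalizing α l l' with
  | zero =>
    have e : IsBetaExpansion β M α a n := ⟨by simpa using h.eq, h.nlt, h.nzero⟩
    have e' : IsBetaExpansion β M α a' n' := ⟨by simpa using h'.eq, h'.nlt, h'.nzero⟩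
    obtain ⟨h1, h2⟩ := isBetaExpansion_unique h0 e e'
    exact ⟨h1, h2, funext fun j => by rw [h.lzero j (by simp), h'.lzero j (by simp)]⟩
  | succ N ih =>
    have key : ∀ {a : ℤ} {n l : ℕ → ℕ}, IsExpansion β γ M (N + 1) α a n l →
        α - l (N + 1) * γ (N + 1) = a * β 0 + ∑ j ∈ Finset.Icc 1 M, (n j : ℚ) * β j
          + ∑ j ∈ Finset.Icc 1 N, (l j : ℚ) * γ j := by
      intro a n l h
      rw [h.eq, Finset.sum_Icc_succ_top (b := N) (by omega)]; ring
    have mem : ∀ {a : ℤ} {n l : ℕ → ℕ}, IsExpansion β γ M (N + 1) α a n l →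
        α - l (N + 1) * γ (N + 1) ∈ H γ N ⊔ GInf β := by
      intro a n l h
      rw [key h]
      refine add_mem (AddSubgroup.mem_sup_right (G_le_GInf M (sum_beta_mem M a n)))
        (AddSubgroup.mem_sup_left (sum_mem fun j hj => ?_))
      rw [← nsmul_eq_mul]
      exact nsmul_mem (AddSubgroup.subset_closure (Set.mem_image_of_mem γ (Finset.mem_Icc.mp hj))) _
    have hN : N + 1 ∈ Finset.Icc 1 (N + 1) := by simp
    have hd : l (N + 1) = l' (N + 1) :=
      digit_unique (A := H γ N ⊔ GInf β) (fun k hk hm => s_min (i := N + 1) hk hm) (h.llt _ hN)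
        (h'.llt _ hN) (mem h) (mem h')
    have trunc : ∀ {a : ℤ} {n l : ℕ → ℕ}, IsExpansion β γ M (N + 1) α a n l →
        IsExpansion β γ M N (α - l (N + 1) * γ (N + 1)) a n (Function.update l (N + 1) 0) := by
      intro a n l h
      refine ⟨?_, h.nlt, ?_, h.nzero, ?_⟩
      · rw [key h]
        congr 1
        refine Finset.sum_congr rfl fun j hj => ?_
        rw [Function.update_of_ne]
        have := Finset.mem_Icc.mp hj; omega
      · intro j hj
        rw [Finset.mem_Icc] at hj
        rw [Function.update_of_ne (by omega)]
        exact h.llt j (by rw [Finset.mem_Icc]; omega)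
      · intro j hj
        rcases eq_or_ne j (N + 1) with rfl | hne
        · simp
        · rw [Function.update_of_ne hne]
          exact h.lzero j (by rw [Finset.mem_Icc] at hj ⊢; omega)
    obtain ⟨ha, hn, hl⟩ := ih (trunc h) (hd ▸ trunc h')
    refine ⟨ha, hn, funext fun j => ?_⟩
    rcases eq_or_ne j (N + 1) with rfl | hne
    · exact hd
    · simpa [Function.update_of_ne hne] using congrFun hl j

theorem betaExp_spec (h0 : β 0 ≠ 0) (i : ℕ) :
    IsBetaExpansion β (i - 1) (q β i * β i) (betaExp β i).1 (betaExp β i).2 := by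
  obtain ⟨a, n, h⟩ := exists_isBetaExpansion h0 (i - 1) _ (q_spec h0 i).2
  exact Classical.epsilon_spec
    (p := fun t : ℤ × (ℕ → ℕ) => IsBetaExpansion β (i - 1) (q β i * β i) t.1 t.2) ⟨(a, n), h⟩

theorem gammaExp_spec (h0 : β 0 ≠ 0) {i : ℕ} (hi : 1 ≤ i) :
    IsExpansion β γ (m β γ i) (i - 1) (s β γ i * γ i)
      (gammaExp β γ i).1 (gammaExp β γ i).2.1 (gammaExp β γ i).2.2 := by
  obtain ⟨i, rfl⟩ : ∃ i', i = i' + 1 := ⟨i - 1, by omega⟩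
  obtain ⟨a, n, l, h⟩ := exists_isExpansion h0 (m β γ (i + 1)) i (le_max_left _ _) _
    (m_spec (γ := γ) h0 le_rfl)
  exact Classical.epsilon_spec
    (p := fun t : ℤ × (ℕ → ℕ) × (ℕ → ℕ) =>
      IsExpansion β γ (m β γ (i + 1)) i (s β γ (i + 1) * γ (i + 1)) t.1 t.2.1 t.2.2)
    ⟨(a, n, l), h⟩

theorem betaExp_pos (hpos : ∀ i, 0 < β i)
    (hβ : ∀ i, 1 ≤ i → (q β i : ℚ) * β i < β (i + 1)) {i : ℕ} (hi : 1 ≤ i) :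
    0 < (betaExp β i).1 := by
  have hsum : ∀ (M : ℕ) (n : ℕ → ℕ), (∀ j ∈ Finset.Icc 1 M, n j < q β j) →
      ∑ j ∈ Finset.Icc 1 M, (n j : ℚ) * β j < β (M + 1) := by
    intro M n
    induction M with
    | zero => intro _; simpa using hpos 1
    | succ M ih =>
      intro h
      rw [Finset.sum_Icc_succ_top (by omega)]
      have h1 := ih fun j hj => h j (by rw [Finset.mem_Icc] at hj ⊢; omega)
      have h2 : ((n (M + 1) + 1 : ℕ) : ℚ) ≤ q β (M + 1) := by
        exact_mod_cast h (M + 1) (by simp)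
      have h3 := mul_le_mul_of_nonneg_right h2 (hpos (M + 1)).le
      have h4 := hβ (M + 1) (by omega)
      push_cast at h3
      linarith
  have h := betaExp_spec (hpos 0).ne' i
  have h1 := hsum (i - 1) _ h.lt
  rw [Nat.sub_add_cancel hi] at h1
  have h2 : (1 : ℚ) ≤ q β i := by exact_mod_cast (q_spec (hpos 0).ne' i).1
  have h3 := mul_le_mul_of_nonneg_right h2 (hpos i).le
  have h4 := h.eq
  have h5 : 0 < ((betaExp β i).1 : ℚ) * β 0 := by linarith
  exact_mod_cast pos_of_mul_pos_left h5 (hpos 0).le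

end Facts

/-! ### The defining polynomials -/

section Polynomials

open MvPolynomial

variable {k : Type*} [Field k]

/-- `P_0 = x`, `P_1 = y`, `P_{i+1} = P_i ^ q_i - λ_i ∏_{j=0}^{i-1} P_j ^ n_{i,j}` for `i ≥ 1`. -/
noncomputable def P (β : ℕ → ℚ) (lam : ℕ → k) : ℕ → MvPolynomial (Fin 3) k
  | 0 => X 0
  | 1 => X 1
  | i + 2 => P β lam (i + 1) ^ q β (i + 1)
      - C (lam (i + 1)) * ∏ j : Fin (i + 1), P β lam j ^ nP β (i + 1) j
decreasing_by all_goals omega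

/-- `Q_1 = z` and
`Q_{i+1} = x ^ r_{i,0} Q_i ^ s_i - μ_i ∏_{j=0}^{m_i} P_j ^ n_{i,j} ∏_{j=1}^{i-1} Q_j ^ l_{i,j}`
for `i ≥ 1`. (The value at `0` is not used.) -/
noncomputable def Q (β γ : ℕ → ℚ) (lam mu : ℕ → k) : ℕ → MvPolynomial (Fin 3) k
  | 0 => 1
  | 1 => X 2
  | i + 2 => X 0 ^ r β γ (i + 1) * Q β γ lam mu (i + 1) ^ s β γ (i + 1)
      - C (mu (i + 1)) * (∏ j ∈ Finset.range (m β γ (i + 1) + 1), P β lam j ^ nQ β γ (i + 1) j)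
        * ∏ j : Fin i, Q β γ lam mu (j + 1) ^ lQ β γ (i + 1) (j + 1)
decreasing_by all_goals omega

theorem P_succ (β : ℕ → ℚ) (lam : ℕ → k) {i : ℕ} (hi : 1 ≤ i) :
    P β lam (i + 1) = P β lam i ^ q β i
      - C (lam i) * ∏ j ∈ Finset.range i, P β lam j ^ nP β i j := by
  obtain ⟨i, rfl⟩ : ∃ i', i = i' + 1 := ⟨i - 1, by omega⟩
  rw [P, Finset.prod_range]

theorem Q_succ (β γ : ℕ → ℚ) (lam mu : ℕ → k) {i : ℕ} (hi : 1 ≤ i) :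
    Q β γ lam mu (i + 1) = X 0 ^ r β γ i * Q β γ lam mu i ^ s β γ i
      - C (mu i) * (∏ j ∈ Finset.range (m β γ i + 1), P β lam j ^ nQ β γ i j)
        * ∏ j ∈ Finset.Icc 1 (i - 1), Q β γ lam mu j ^ lQ β γ i j := by
  obtain ⟨i, rfl⟩ : ∃ i', i = i' + 1 := ⟨i - 1, by omega⟩
  have h : ∏ j : Fin i, Q β γ lam mu (j + 1) ^ lQ β γ (i + 1) (j + 1)
      = ∏ j ∈ Finset.Icc 1 (i + 1 - 1), Q β γ lam mu j ^ lQ β γ (i + 1) j := by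
    rw [← Finset.prod_range (fun j => Q β γ lam mu (j + 1) ^ lQ β γ (i + 1) (j + 1)),
      Finset.range_eq_Ico,
      Finset.prod_Ico_add' (fun j => Q β γ lam mu j ^ lQ β γ (i + 1) j) 0 i 1]
    rfl
  rw [Q, h]

end Polynomials

/-! ### The local ring and domination -/

section LocalRing

open MvPolynomial

/-- The field `k(x, y, z)`. -/
abbrev RatFun (k : Type*) [Field k] : Type _ := FractionRing (MvPolynomial (Fin 3) k)

/-- The ideal `(x, y, z)` of `k[x, y, z]`. -/
noncomputable def originIdeal (k : Type*) [Field k] : Ideal (MvPolynomial (Fin 3) k) :=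
  Ideal.span {X 0, X 1, X 2}

theorem originIdeal_eq_ker (k : Type*) [Field k] :
    originIdeal k = RingHom.ker (constantCoeff : MvPolynomial (Fin 3) k →+* k) := by
  have h : originIdeal k = idealOfVars (Fin 3) k := by
    rw [originIdeal, idealOfVars]
    congr 1
    ext p
    simp [Fin.exists_fin_succ, eq_comm]
  ext p
  rw [h, RingHom.mem_ker, ← pow_one (idealOfVars (Fin 3) k), mem_pow_idealOfVars_iff',
    constantCoeff_eq]
  simp [Finsupp.degree_eq_zero_iff]

instance originIdeal_isPrime (k : Type*) [Field k] : (originIdeal k).IsPrime := by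
  rw [originIdeal_eq_ker]
  exact RingHom.ker_isPrime _

/-- The local ring `k[x, y, z]_{(x, y, z)}`, as a subring of `k(x, y, z)`: all fractions `f / g`
with `f, g ∈ k[x, y, z]` and `g ∉ (x, y, z)`. -/
noncomputable def localRing (k : Type*) [Field k] :
    Subalgebra (MvPolynomial (Fin 3) k) (RatFun k) :=
  Localization.subalgebra.ofField (RatFun k) (originIdeal k).primeCompl
    (originIdeal k).primeCompl_le_nonZeroDivisors

instance localRing_isLocalization (k : Type*) [Field k] :
    IsLocalization.AtPrime (localRing k) (originIdeal k) :=
  Localization.subalgebra.isLocalization_ofField _ _ _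

instance localRing_isLocalRing (k : Type*) [Field k] : IsLocalRing (localRing k) :=
  IsLocalization.AtPrime.isLocalRing (localRing k) (originIdeal k)

/-- A `ℚ`-valued (additive) valuation `ν` of a field `K`, with valuation ring
`V = {f | 0 ≤ ν f}` and maximal ideal `m_V = {f | 0 < ν f}`, dominates a local subring `R` of `K`
if `R ⊆ V` and `m_V ∩ R = m_R`. -/
def Dominates {A K : Type*} [CommRing A] [Field K] [Algebra A K]
    (ν : AddValuation K (WithTop ℚ)) (R : Subalgebra A K) [IsLocalRing R] : Prop :=
  (∀ f : R, 0 ≤ ν (f : K)) ∧ ∀ f : R, 0 < ν (f : K) ↔ f ∈ IsLocalRing.maximalIdeal R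

end LocalRing

end DefSeq

/-! The valuation is built along the tower `k ⊂ k[x] ⊂ k[x][y] ⊂ k(x,y) ⊂ k(x,y)[z] ⊂ k(x,y,z)`. The
passages to fraction fields are formal, and the `x`-adic step is elementary. The steps adjoining `y`
and `z` are two instances of one statement, `IsKeySequence.exists_valuation`, applied to the `P_i`
over `k[x]` and to the `Q_i` over `k(x,y)`, with indices shifted to start at `0`.

Let `F` be a domain with a valuation `v` and key polynomials `Q_{i+1} = u_i Q_i^{s_i} - c_i ∏_{j<i}
Q_j^{d_{i,j}}`, where `u_i` is a unit. The degree of `∏ Q_j^{l_j}` is the number with digits `l_j`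
in the mixed radix system with radices `s_j`, and its leading coefficient is a unit. Hence the
standard monomials (`l_j < s_j` for all `j`) have distinct degrees and are independent. Reading the
recursion as a rewriting rule shows that they span; the rewriting terminates because infinitely many
`s_i` exceed `1` (`radix_induction`). So they form an `F`-basis of `F[X]`, and the candidate
valuation is the minimum over terms of `v(coefficient) + ∑ l_j γ_j`.

Two facts make it a valuation. By minimality of the `s_i`, distinct terms never have equal values
(`eq_of_weight_sub_mem`), so every nonzero polynomial has a unique leading term. And every monomial,
standard or not, has value `∑ l_j γ_j` (`basisVal_mono`): in `u_i Q_i^{s_i} = c_i ∏ Q_j^{d_{i,j}} +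
Q_{i+1}` the product on the right has the expected value of the left side, and the growth condition
makes `Q_{i+1}` strictly larger. Products of leading terms therefore behave correctly, which gives
multiplicativity (`basisVal_mul`).

Any other valuation with the same values on `F` and on the `Q_i` agrees on each term, hence on sums
of terms with distinct values (`eq_valuation`). Domination forces value `0` on nonzero constants,
which starts the uniqueness argument at the bottom of the tower. -/

namespace DefSeq

open Module

/-! ### Valuations defined by a valued basis -/

section ValuedBasis

variable {F A ι : Type*} [CommRing F] [CommRing A] [Algebra F A]

/-- The function `∑ f_i b_i ↦ min (v f_i + w i)` on an algebra `A` with basis `b`. -/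
noncomputable def basisVal (v : AddValuation F (WithTop ℚ)) (b : Basis ι F A) (w : ι → ℚ) (f : A) :
    WithTop ℚ :=
  (b.repr f).support.inf fun i => v (b.repr f i) + ((w i : ℚ) : WithTop ℚ)

variable {v : AddValuation F (WithTop ℚ)} {b : Basis ι F A} {w : ι → ℚ}

theorem le_basisVal {r : WithTop ℚ} {f : A} :
    r ≤ basisVal v b w f ↔ ∀ i, r ≤ v (b.repr f i) + ((w i : ℚ) : WithTop ℚ) := by
  rw [basisVal, Finset.le_inf_iff]
  refine ⟨fun h i => ?_, fun h i _ => h i⟩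
  by_cases hi : b.repr f i = 0
  · simp [hi]
  · exact h i (Finsupp.mem_support_iff.mpr hi)

theorem basisVal_le (f : A) (i : ι) :
    basisVal v b w f ≤ v (b.repr f i) + ((w i : ℚ) : WithTop ℚ) :=
  le_basisVal.mp le_rfl i

theorem lt_basisVal {r : WithTop ℚ} (hr : r < ⊤) {f : A} :
    r < basisVal v b w f ↔ ∀ i, r < v (b.repr f i) + ((w i : ℚ) : WithTop ℚ) := by
  refine ⟨fun h i => h.trans_le (basisVal_le f i), fun h => ?_⟩
  rw [basisVal, Finset.lt_inf_iff hr]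
  exact fun i _ => h i

theorem basisVal_zero : basisVal v b w (0 : A) = ⊤ := by simp [basisVal]

theorem exists_basisVal_eq {f : A} (hf : f ≠ 0) :
    ∃ i, b.repr f i ≠ 0 ∧ basisVal v b w f = v (b.repr f i) + ((w i : ℚ) : WithTop ℚ) := by
  have hne : (b.repr f).support.Nonempty := by
    rw [Finsupp.support_nonempty_iff]
    simpa using hf
  obtain ⟨i, hi, h⟩ := Finset.exists_mem_eq_inf _ hne
    fun i => v (b.repr f i) + ((w i : ℚ) : WithTop ℚ)
  exact ⟨i, Finsupp.mem_support_iff.mp hi, h⟩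

theorem min_le_basisVal_add (f g : A) :
    min (basisVal v b w f) (basisVal v b w g) ≤ basisVal v b w (f + g) := by
  rw [le_basisVal]
  intro i
  rw [map_add, Finsupp.add_apply]
  have h := add_le_add_left (v.map_add (b.repr f i) (b.repr g i)) ((w i : ℚ) : WithTop ℚ)
  refine le_trans ?_ h
  rw [min_add]
  exact min_le_min (basisVal_le f i) (basisVal_le g i)

theorem le_basisVal_sum {κ : Type*} {s : Finset κ} {f : κ → A} {r : WithTop ℚ}
    (h : ∀ i ∈ s, r ≤ basisVal v b w (f i)) : r ≤ basisVal v b w (∑ i ∈ s, f i) := by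
  classical
  induction s using Finset.induction_on with
  | empty => simp [basisVal_zero]
  | insert a s ha ih =>
    rw [Finset.sum_insert ha]
    refine le_trans (le_min (h a (Finset.mem_insert_self a s)) (ih fun i hi => ?_))
      (min_le_basisVal_add _ _)
    exact h i (Finset.mem_insert_of_mem hi)

theorem basisVal_smul (a : F) (f : A) :
    basisVal v b w (a • f) = v a + basisVal v b w f := by
  refine le_antisymm ?_ ?_
  · rcases eq_or_ne f 0 with rfl | hf
    · simp [basisVal_zero]
    · obtain ⟨i, -, h⟩ := exists_basisVal_eq (v := v) (b := b) (w := w) hf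
      refine (basisVal_le _ i).trans ?_
      rw [h, map_smul, Finsupp.smul_apply, smul_eq_mul, v.map_mul, add_assoc]
  · rw [le_basisVal]
    intro i
    rw [map_smul, Finsupp.smul_apply, smul_eq_mul, v.map_mul, add_assoc]
    gcongr
    exact basisVal_le f i

theorem basisVal_basis (i : ι) : basisVal v b w (b i) = ((w i : ℚ) : WithTop ℚ) := by
  refine le_antisymm ?_ ?_
  · simpa using basisVal_le (v := v) (b := b) (w := w) (b i) i
  · rw [le_basisVal]
    intro j
    rcases eq_or_ne i j with rfl | hij
    · simp
    · simp [Finsupp.single_eq_of_ne' hij]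

theorem basisVal_neg (f : A) : basisVal v b w (-f) = basisVal v b w f := by
  have := basisVal_smul (v := v) (b := b) (w := w) (-1) f
  simpa [v.map_neg] using this

theorem basisVal_add_eq_of_lt {f g : A} (h : basisVal v b w f < basisVal v b w g) :
    basisVal v b w (f + g) = basisVal v b w f := by
  refine le_antisymm ?_ ?_
  · by_contra! hlt
    have h1 := min_le_basisVal_add (v := v) (b := b) (w := w) (f + g) (-g)
    rw [basisVal_neg, add_neg_cancel_right] at h1
    exact absurd h1 (not_le.mpr (lt_min hlt h))
  · exact (le_min le_rfl h.le).trans (min_le_basisVal_add f g)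

/-- The terms `f_i b_i` have distinct values, and values of products of basis elements are
as expected. -/
structure IsValuedBasis (v : AddValuation F (WithTop ℚ)) (b : Basis ι F A) (w : ι → ℚ) : Prop where
  eq_zero_of_eq_top : ∀ a, v a = ⊤ → a = 0
  inj : ∀ i j a c, a ≠ 0 → c ≠ 0 →
    v a + ((w i : ℚ) : WithTop ℚ) = v c + ((w j : ℚ) : WithTop ℚ) → i = j
  mul : ∀ i j, basisVal v b w (b i * b j) = ((w i + w j : ℚ) : WithTop ℚ)

namespace IsValuedBasis

theorem basisVal_eq_top (h : IsValuedBasis v b w) {f : A} (hf : basisVal v b w f = ⊤) : f = 0 := by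
  by_contra hne
  obtain ⟨i, hi, hv⟩ := exists_basisVal_eq (v := v) (b := b) (w := w) hne
  rw [hf, eq_comm, WithTop.add_eq_top] at hv
  exact hi (h.eq_zero_of_eq_top _ (by simpa using hv))

/-- Since the terms have pairwise distinct values, the minimum is attained exactly once, and
removing that term strictly raises the value. -/
theorem exists_lead (h : IsValuedBasis v b w) {f : A} (hf : f ≠ 0) :
    ∃ i a f', a ≠ 0 ∧ f = a • b i + f' ∧ basisVal v b w f = v a + ((w i : ℚ) : WithTop ℚ) ∧
      basisVal v b w f < basisVal v b w f' := by
  classical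
  obtain ⟨i, hi, hv⟩ := exists_basisVal_eq (v := v) (b := b) (w := w) hf
  refine ⟨i, b.repr f i, f - b.repr f i • b i, hi, by abel, hv, ?_⟩
  have htop : basisVal v b w f < ⊤ := lt_top_iff_ne_top.mpr fun ht => hf (h.basisVal_eq_top ht)
  rw [lt_basisVal htop]
  intro j
  rcases eq_or_ne i j with rfl | hij
  · simpa using htop
  · have : b.repr (f - b.repr f i • b i) j = b.repr f j := by
      simp [Finsupp.single_eq_of_ne' hij]
    rw [this]
    rcases eq_or_ne (b.repr f j) 0 with h0 | h0
    · simpa [h0] using htop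
    · refine lt_of_le_of_ne (basisVal_le f j) fun he => hij ?_
      exact h.inj i j _ _ hi h0 (hv ▸ he)

theorem add_le_basisVal_mul (h : IsValuedBasis v b w) (f g : A) :
    basisVal v b w f + basisVal v b w g ≤ basisVal v b w (f * g) := by
  have hf := b.linearCombination_repr f
  have hg := b.linearCombination_repr g
  rw [Finsupp.linearCombination_apply, Finsupp.sum] at hf hg
  have : f * g = ∑ i ∈ (b.repr f).support, ∑ j ∈ (b.repr g).support,
      (b.repr f i * b.repr g j) • (b i * b j) := by
    conv_lhs => rw [← hf, ← hg]
    rw [Finset.sum_mul_sum]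
    simp only [smul_mul_smul_comm]
  rw [this]
  refine le_basisVal_sum fun i _ => le_basisVal_sum fun j _ => ?_
  rw [basisVal_smul, h.mul, v.map_mul, WithTop.coe_add, add_add_add_comm]
  exact add_le_add (basisVal_le f i) (basisVal_le g j)

/-- The product of the two leading terms has the expected value by `h.mul`; all other contributions
are strictly larger, so they cannot cancel it. -/
theorem basisVal_mul (h : IsValuedBasis v b w) (f g : A) :
    basisVal v b w (f * g) = basisVal v b w f + basisVal v b w g := by
  rcases eq_or_ne f 0 with rfl | hf
  · simp [basisVal_zero]
  rcases eq_or_ne g 0 with rfl | hg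
  · simp [basisVal_zero]
  have hft : basisVal v b w f ≠ ⊤ := fun ht => hf (h.basisVal_eq_top ht)
  have hgt : basisVal v b w g ≠ ⊤ := fun ht => hg (h.basisVal_eq_top ht)
  obtain ⟨i, a, f', -, hfe, hfv, hf'⟩ := h.exists_lead hf
  obtain ⟨j, c, g', -, hge, hgv, hg'⟩ := h.exists_lead hg
  have hlead : basisVal v b w (a • b i * c • b j) = basisVal v b w f + basisVal v b w g := by
    rw [smul_mul_smul_comm, basisVal_smul, h.mul, v.map_mul, WithTop.coe_add, add_add_add_comm,
      hfv, hgv]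
  have h1 : basisVal v b w f + basisVal v b w g < basisVal v b w (a • b i * g') := by
    refine lt_of_lt_of_le ?_ (h.add_le_basisVal_mul _ _)
    rw [basisVal_smul, basisVal_basis, ← hfv]
    exact (WithTop.add_lt_add_iff_left hft).mpr hg'
  have h2 : basisVal v b w f + basisVal v b w g < basisVal v b w (f' * g) := by
    refine lt_of_lt_of_le ?_ (h.add_le_basisVal_mul _ _)
    exact (WithTop.add_lt_add_iff_right hgt).mpr hf'
  have h3 : f * g = a • b i * c • b j + (a • b i * g' + f' * g) := by
    conv_lhs => rw [hfe, add_mul]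
    conv_lhs => enter [1, 2]; rw [hge]
    ring
  rw [h3, basisVal_add_eq_of_lt, hlead]
  rw [hlead]
  exact (lt_min h1 h2).trans_le (min_le_basisVal_add _ _)

/-- The valuation given by a valued basis. -/
noncomputable def valuation [Nontrivial A] (h : IsValuedBasis v b w) :
    AddValuation A (WithTop ℚ) :=
  AddValuation.of (basisVal v b w) basisVal_zero
    (by
      -- The value of `1` is finite and equal to its own double, hence zero.
      have h1 := h.basisVal_mul 1 1
      have h2 : basisVal v b w (1 : A) ≠ ⊤ := fun ht => one_ne_zero (h.basisVal_eq_top ht)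
      rw [mul_one] at h1
      lift basisVal v b w (1 : A) to ℚ using h2 with r
      norm_cast at h1 ⊢
      linarith)
    min_le_basisVal_add h.basisVal_mul

variable [Nontrivial A]

theorem valuation_basis (h : IsValuedBasis v b w) (i : ι) :
    h.valuation (b i) = ((w i : ℚ) : WithTop ℚ) :=
  basisVal_basis i

theorem valuation_algebraMap (h : IsValuedBasis v b w) (a : F) :
    h.valuation (algebraMap F A a) = v a := by
  have h1 : h.valuation (a • (1 : A)) = v a + h.valuation 1 := basisVal_smul a 1
  rwa [AddValuation.map_one, add_zero, ← Algebra.algebraMap_eq_smul_one] at h1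

theorem exists_valuation_eq (h : IsValuedBasis v b w) {f : A} (hf : f ≠ 0) :
    ∃ i a, a ≠ 0 ∧ h.valuation f = v a + ((w i : ℚ) : WithTop ℚ) := by
  obtain ⟨i, hi, hv⟩ := exists_basisVal_eq (v := v) (b := b) (w := w) hf
  exact ⟨i, _, hi, hv⟩

/-- The ultrametric inequality on the basis expansion gives `≥`; equality follows because the
leading term strictly dominates the rest for `μ` as well. -/
theorem eq_valuation (h : IsValuedBasis v b w) (μ : AddValuation A (WithTop ℚ))
    (hμ : ∀ a, μ (algebraMap F A a) = v a) (hμb : ∀ i, μ (b i) = ((w i : ℚ) : WithTop ℚ)) :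
    μ = h.valuation := by
  have hle : ∀ f, h.valuation f ≤ μ f := by
    intro f
    have hf := b.linearCombination_repr f
    rw [Finsupp.linearCombination_apply, Finsupp.sum] at hf
    conv_rhs => rw [← hf]
    refine μ.map_le_sum fun i _ => ?_
    rw [Algebra.smul_def, μ.map_mul, hμ, hμb]
    exact basisVal_le f i
  ext f
  rcases eq_or_ne f 0 with rfl | hf
  · simp
  obtain ⟨i, a, f', -, hfe, hfv, hf'⟩ := h.exists_lead hf
  have h1 : μ (a • b i) = h.valuation f := by
    rw [Algebra.smul_def, μ.map_mul, hμ, hμb]; exact hfv.symm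
  have h2 : h.valuation f < μ f' := hf'.trans_le (hle f')
  rw [← h1] at h2 ⊢
  conv_lhs => rw [hfe]
  exact μ.map_add_eq_of_lt_left h2

end IsValuedBasis

theorem eq_zero_of_valuation_eq_top {A : Type*} [CommRing A] {v : AddValuation A (WithTop ℚ)}
    {V : AddSubgroup ℚ} (h : ∀ a, a ≠ 0 → ∃ g ∈ V, v a = ((g : ℚ) : WithTop ℚ)) (a : A)
    (ha : v a = ⊤) : a = 0 := by
  by_contra h0
  obtain ⟨g, -, hg⟩ := h a h0
  exact WithTop.top_ne_coe (ha.symm.trans hg)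

end ValuedBasis

/-! ### Mixed radix expansions -/

section MixedRadix

variable {s : ℕ → ℕ}

/-- The place values of the mixed radix system with radices `s 0, s 1, …`. -/
def place (s : ℕ → ℕ) (i : ℕ) : ℕ := ∏ j ∈ Finset.range i, s j

theorem place_succ (s : ℕ → ℕ) (i : ℕ) : place s (i + 1) = place s i * s i :=
  Finset.prod_range_succ _ _

theorem place_pos (hs : ∀ i, 0 < s i) (i : ℕ) : 0 < place s i :=
  Finset.prod_pos fun _ _ => hs _

theorem place_mono (hs : ∀ i, 0 < s i) : Monotone (place s) :=
  monotone_nat_of_le_succ fun i => by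
    rw [place_succ]; exact Nat.le_mul_of_pos_right _ (hs i)

theorem exists_lt_place (hs : ∀ i, 0 < s i) (hinf : {i | 1 < s i}.Infinite) (D : ℕ) :
    ∃ N, D < place s N := by
  induction D with
  | zero => exact ⟨0, place_pos hs 0⟩
  | succ D ih =>
    obtain ⟨N, hN⟩ := ih
    obtain ⟨i, hi, hNi⟩ := hinf.exists_gt N
    refine ⟨i + 1, ?_⟩
    have h1 := place_mono hs hNi.le
    have h2 : place s i * 2 ≤ place s i * s i := Nat.mul_le_mul_left _ hi
    rw [place_succ]
    omega

/-- The weight `∑ l_j w_j` of an exponent vector. -/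
noncomputable def weight {M : Type*} [AddCommMonoid M] (w : ℕ → M) (l : ℕ →₀ ℕ) : M :=
  l.sum fun j n => n • w j

section Weight

variable {M : Type*} [AddCommMonoid M] (w : ℕ → M)

theorem weight_add (l l' : ℕ →₀ ℕ) : weight w (l + l') = weight w l + weight w l' :=
  Finsupp.sum_add_index' (fun j => zero_nsmul (w j)) fun _ _ _ => add_nsmul _ _ _

theorem weight_single (i n : ℕ) : weight w (Finsupp.single i n) = n • w i :=
  Finsupp.sum_single_index (zero_nsmul _)

theorem weight_zero : weight w 0 = 0 := Finsupp.sum_zero_index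

theorem weight_eq_erase_add (l : ℕ →₀ ℕ) (i : ℕ) :
    weight w l = weight w (l.erase i) + l i • w i := by
  conv_lhs => rw [← Finsupp.erase_add_single i l, weight_add, weight_single]

end Weight

theorem weight_lt_place {l : ℕ →₀ ℕ} {N : ℕ} (hstd : ∀ j < N, l j < s j)
    (hN : ∀ j, N ≤ j → l j = 0) : weight (place s) l < place s N := by
  induction N generalizing l with
  | zero =>
    have : l = 0 := Finsupp.ext fun j => hN j (Nat.zero_le _)
    simp [this, weight_zero, place]
  | succ N ih =>
    have h1 : weight (place s) (l.erase N) < place s N := by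
      refine ih (fun j hj => ?_) fun j hj => ?_
      · rw [Finsupp.erase_ne hj.ne]; exact hstd j (by omega)
      · rcases eq_or_ne j N with rfl | hne
        · simp
        · rw [Finsupp.erase_ne hne]; exact hN j (by omega)
    have h2 : (l N + 1) * place s N ≤ s N * place s N :=
      Nat.mul_le_mul_right _ (hstd N (Nat.lt_succ_self N))
    rw [weight_eq_erase_add _ l N, place_succ, smul_eq_mul]
    linarith

/-- The top digit is the quotient by `place s N`, since the lower digits contribute less than one
such unit; then induct on the number of digits. -/
theorem weight_place_injective {l l' : ℕ →₀ ℕ} (h : ∀ j, l j < s j)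
    (h' : ∀ j, l' j < s j) (he : weight (place s) l = weight (place s) l') : l = l' := by
  obtain ⟨N, hN, hN'⟩ : ∃ N, (∀ j, N ≤ j → l j = 0) ∧ ∀ j, N ≤ j → l' j = 0 := by
    obtain ⟨N, hN⟩ := (l.support ∪ l'.support).exists_nat_subset_range
    refine ⟨N, fun j hj => ?_, fun j hj => ?_⟩ <;> by_contra h0
    · have := Finset.mem_range.mp (hN (Finset.mem_union_left _ (Finsupp.mem_support_iff.mpr h0)))
      omega
    · have := Finset.mem_range.mp (hN (Finset.mem_union_right _ (Finsupp.mem_support_iff.mpr h0)))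
      omega
  replace h : ∀ j < N, l j < s j := fun j _ => h j
  replace h' : ∀ j < N, l' j < s j := fun j _ => h' j
  induction N generalizing l l' with
  | zero => exact Finsupp.ext fun j => (hN j (Nat.zero_le _)).trans (hN' j (Nat.zero_le _)).symm
  | succ N ih =>
    have erase_lt : ∀ {l : ℕ →₀ ℕ}, (∀ j < N + 1, l j < s j) → ∀ j < N, (l.erase N) j < s j := by
      intro l h j hj
      rw [Finsupp.erase_ne hj.ne]; exact h j (by omega)
    have erase_zero : ∀ {l : ℕ →₀ ℕ}, (∀ j, N + 1 ≤ j → l j = 0) →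
        ∀ j, N ≤ j → (l.erase N) j = 0 := by
      intro l hN j hj
      rcases eq_or_ne j N with rfl | hne
      · simp
      · rw [Finsupp.erase_ne hne]; exact hN j (by omega)
    have b := weight_lt_place (erase_lt h) (erase_zero hN)
    have b' := weight_lt_place (erase_lt h') (erase_zero hN')
    rw [weight_eq_erase_add _ l N, weight_eq_erase_add _ l' N, smul_eq_mul, smul_eq_mul] at he
    have hd : l N = l' N := by
      have e1 := Nat.add_mul_div_right (weight (place s) (l.erase N)) (l N) (by omega : 0 < place s N)
      have e2 := Nat.add_mul_div_right (weight (place s) (l'.erase N)) (l' N)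
        (by omega : 0 < place s N)
      rw [Nat.div_eq_of_lt b] at e1
      rw [Nat.div_eq_of_lt b'] at e2
      rw [he] at e1
      omega
    rw [hd] at he
    have hers := ih (Nat.add_right_cancel he) (erase_zero hN) (erase_zero hN') (erase_lt h)
      (erase_lt h')
    rw [← Finsupp.erase_add_single N l, ← Finsupp.erase_add_single N l', hers, hd]

/-- Induction along the rewriting rule that replaces `s i` copies of the index `i` either by one
copy of `i + 1`, or by a vector of digits supported below `i`. -/
theorem radix_induction (hs : ∀ i, 0 < s i) (hinf : {i | 1 < s i}.Infinite) {d : ℕ → ℕ →₀ ℕ}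
    (hd : ∀ i j, d i j < s j) (hd0 : ∀ i j, i ≤ j → d i j = 0) {p : (ℕ →₀ ℕ) → Prop}
    (hstd : ∀ l, (∀ j, l j < s j) → p l)
    (hred : ∀ l i, p (l + Finsupp.single (i + 1) 1) → p (l + d i) →
      p (l + Finsupp.single i (s i)))
    (l : ℕ →₀ ℕ) : p l := by
  obtain ⟨N, hN⟩ := exists_lt_place hs hinf (weight (place s) l)
  -- Termination is lexicographic in the pair (`∑ l_j place_j`, `∑ l_j (N - j)`). A carry from `i`
  -- to `i + 1` keeps the first entry and lowers the second, even when `s i = 1`. Replacing by `d i`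
  -- lowers the first, as lower digits weigh less than `place s i`. The bound `D < place s N` forces
  -- `i < N`, so the truncated subtraction `N - i` is positive.
  suffices H : ∀ D m (l : ℕ →₀ ℕ), weight (place s) l = D → weight (fun j => N - j) l = m →
      D < place s N → p l from H _ _ l rfl rfl hN
  intro D
  induction D using Nat.strong_induction_on with | _ D ihD
  intro m
  induction m using Nat.strong_induction_on with | _ m ihm
  intro l hl hm hDN
  by_cases hl' : ∀ j, l j < s j
  · exact hstd l hl'
  push Not at hl'
  obtain ⟨i, hi⟩ := hl'
  obtain ⟨l', rfl⟩ : ∃ l', l = l' + Finsupp.single i (s i) :=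
    ⟨l - Finsupp.single i (s i), (tsub_add_cancel_of_le (by simpa using hi)).symm⟩
  rw [weight_add, weight_single, smul_eq_mul] at hl hm
  have h1 : place s i ≤ s i * place s i := Nat.le_mul_of_pos_left _ (hs i)
  have hiN : i < N := by
    by_contra! hle
    have := place_mono hs hle
    omega
  refine hred l' i (ihm _ ?_ _ ?_ rfl hDN) (ihD _ ?_ _ _ rfl rfl ?_)
  · rw [weight_add, weight_single, one_smul, ← hm]
    have h2 : N - i ≤ s i * (N - i) := Nat.le_mul_of_pos_left _ (hs i)
    omega
  · rw [weight_add, weight_single, one_smul, place_succ, ← hl, mul_comm (s i)]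
  all_goals
    have := weight_lt_place (s := s) (N := i) (fun j _ => hd i j) (hd0 i)
    rw [weight_add]
    omega

end MixedRadix

/-! ### Monomials in a sequence of elements -/

section Mono

variable {A : Type*} [CommRing A]

/-- The monomial `∏ Q_j ^ l_j`. -/
noncomputable def mono (Q : ℕ → A) (l : ℕ →₀ ℕ) : A := l.prod fun j n => Q j ^ n

theorem mono_add (Q : ℕ → A) (l l' : ℕ →₀ ℕ) : mono Q (l + l') = mono Q l * mono Q l' :=
  Finsupp.prod_add_index' (fun j => pow_zero (Q j)) fun _ _ _ => pow_add _ _ _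

theorem mono_single (Q : ℕ → A) (i n : ℕ) : mono Q (Finsupp.single i n) = Q i ^ n :=
  Finsupp.prod_single_index (pow_zero _)

theorem valuation_mono (μ : AddValuation A (WithTop ℚ)) {Q : ℕ → A} {γ : ℕ → ℚ}
    (h : ∀ i, μ (Q i) = ((γ i : ℚ) : WithTop ℚ)) (l : ℕ →₀ ℕ) :
    μ (mono Q l) = ((weight γ l : ℚ) : WithTop ℚ) := by
  induction l using Finsupp.induction_linear with
  | zero => simp [mono, weight_zero]
  | add l l' hl hl' => rw [mono_add, μ.map_mul, hl, hl', weight_add, WithTop.coe_add]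
  | single i n => rw [mono_single, μ.map_pow, h, weight_single, WithTop.coe_nsmul]

end Mono

/-! ### Extending a valuation to a polynomial ring by a key sequence -/

open Polynomial

section KeySequence

variable {F : Type*} [CommRing F]

/-- A sequence of key polynomials `Q_0 = X`, `Q_{i+1} = u_i Q_i ^ s_i - c_i ∏_{j<i} Q_j ^ d_{i,j}`
over a valued domain `F`, with prescribed values `γ_i`. -/
structure IsKeySequence (v : AddValuation F (WithTop ℚ)) (V : AddSubgroup ℚ) (γ : ℕ → ℚ)
    (s : ℕ → ℕ) (u : ℕ → Fˣ) (c : ℕ → F) (d : ℕ → ℕ →₀ ℕ) (Q : ℕ → F[X]) : Prop where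
  exists_val : ∀ a, a ≠ 0 → ∃ g ∈ V, v a = ((g : ℚ) : WithTop ℚ)
  zero : Q 0 = X
  succ : ∀ i, Q (i + 1) = C (u i : F) * Q i ^ s i - C (c i) * mono Q (d i)
  pos : ∀ i, 0 < s i
  infinite : {i | 1 < s i}.Infinite
  min : ∀ i (n : ℕ), 0 < n → (n : ℚ) * γ i ∈ V ⊔ AddSubgroup.closure (γ '' Set.Iio i) → s i ≤ n
  digit_lt : ∀ i j, d i j < s j
  digit_zero : ∀ i j, i ≤ j → d i j = 0
  val_eq : ∀ i, v (u i : F) + ((s i * γ i : ℚ) : WithTop ℚ)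
    = v (c i) + ((weight γ (d i) : ℚ) : WithTop ℚ)
  val_lt : ∀ i, v (u i : F) + ((s i * γ i : ℚ) : WithTop ℚ) < ((γ (i + 1) : ℚ) : WithTop ℚ)

namespace IsKeySequence

variable {v : AddValuation F (WithTop ℚ)} {V : AddSubgroup ℚ} {γ : ℕ → ℚ} {s : ℕ → ℕ}
  {u : ℕ → Fˣ} {c : ℕ → F} {d : ℕ → ℕ →₀ ℕ} {Q : ℕ → F[X]}

/-- Leading coefficients are units, so degrees add. Only finitely many `Q j` are assumed controlled,
so that `degree` can use this inside its own induction. -/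
theorem mono_degree_of {N : ℕ} (hQ : ∀ j < N, (Q j).natDegree ≤ place s j ∧
      IsUnit ((Q j).coeff (place s j))) (l : ℕ →₀ ℕ) (hl : ∀ j, N ≤ j → l j = 0) :
    (mono Q l).natDegree ≤ weight (place s) l ∧
      IsUnit ((mono Q l).coeff (weight (place s) l)) := by
  induction l using Finsupp.induction with
  | zero => simp [mono, weight_zero]
  | single_add i n l hi hn ih =>
    have hl0 : ∀ j, N ≤ j → l j = 0 := fun j hj => by
      have := hl j hj
      rw [Finsupp.add_apply] at this
      omega
    have hiN : i < N := by
      by_contra! h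
      have := hl i h
      rw [Finsupp.add_apply, Finsupp.single_eq_same] at this
      omega
    obtain ⟨h1, h2⟩ := ih hl0
    obtain ⟨h3, h4⟩ := hQ i hiN
    have h5 : (Q i ^ n).natDegree ≤ n * place s i := natDegree_pow_le_of_le n h3
    rw [mono_add, mono_single, weight_add, weight_single, smul_eq_mul]
    refine ⟨natDegree_mul_le_of_le h5 h1, ?_⟩
    rw [coeff_mul_add_eq_of_natDegree_le h5 h1, coeff_pow_of_natDegree_le h3]
    exact (h4.pow n).mul h2

/-- The subtracted monomial has digits below `i`, hence degree less than `place s i`, and cannot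
affect the leading term of `u_i Q_i ^ s_i`. -/
theorem degree (h : IsKeySequence v V γ s u c d Q) (i : ℕ) :
    (Q i).natDegree ≤ place s i ∧ IsUnit ((Q i).coeff (place s i)) := by
  induction i using Nat.strong_induction_on with | _ i ih
  rcases i with _ | i
  · rw [h.zero]
    simp [place, natDegree_X_le]
  · obtain ⟨h1, h2⟩ := ih i (Nat.lt_succ_self i)
    have h3 := (mono_degree_of (N := i) (fun j hj => ih j (by omega)) (d i) (h.digit_zero i)).1
    have h4 := weight_lt_place (s := s) (N := i) (fun j _ => h.digit_lt i j) (h.digit_zero i)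
    have h5 : place s i ≤ place s i * s i := Nat.le_mul_of_pos_right _ (h.pos i)
    have h6 : (Q i ^ s i).natDegree ≤ s i * place s i := natDegree_pow_le_of_le _ h1
    rw [h.succ, place_succ, mul_comm (place s i)] at *
    have h7 : (C (c i) * mono Q (d i)).natDegree < s i * place s i :=
      ((natDegree_C_mul_le _ _).trans h3).trans_lt (by omega)
    refine ⟨(natDegree_sub_le _ _).trans (max_le ((natDegree_C_mul_le _ _).trans h6) h7.le), ?_⟩
    rw [coeff_sub, coeff_eq_zero_of_natDegree_lt h7, sub_zero, coeff_C_mul,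
      coeff_pow_of_natDegree_le h1]
    exact (u i).isUnit.mul (h2.pow _)

theorem mono_degree (h : IsKeySequence v V γ s u c d Q) (l : ℕ →₀ ℕ) :
    (mono Q l).natDegree ≤ weight (place s) l ∧
      IsUnit ((mono Q l).coeff (weight (place s) l)) := by
  obtain ⟨N, hN⟩ := l.support.exists_nat_subset_range
  refine mono_degree_of (N := N) (fun j _ => h.degree j) l fun j hj => ?_
  by_contra h0
  have := Finset.mem_range.mp (hN (Finsupp.mem_support_iff.mpr h0))
  omega

/-- Standard monomials have distinct degrees: in a relation, take the term of largest degree with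
nonzero coefficient and compare coefficients in that degree. -/
theorem linearIndependent (h : IsKeySequence v V γ s u c d Q) :
    LinearIndependent F fun l : {l : ℕ →₀ ℕ // ∀ j, l j < s j} => mono Q l.1 := by
  classical
  rw [linearIndependent_iff']
  intro t g hg i hi
  by_contra hgi
  obtain ⟨l, hl, hmax⟩ := (t.filter fun i => g i ≠ 0).exists_max_image
    (fun l => weight (place s) l.1) ⟨i, by simp [hi, hgi]⟩
  rw [Finset.mem_filter] at hl
  have h1 := congrArg (fun f => f.coeff (weight (place s) l.1)) hg
  simp only [finsetSum_coeff, coeff_smul, coeff_zero, smul_eq_mul] at h1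
  rw [Finset.sum_eq_single l] at h1
  · exact hl.2 ((h.mono_degree l.1).2.mul_left_eq_zero.mp h1)
  · intro l' hl' hne
    rcases eq_or_ne (g l') 0 with h0 | h0
    · rw [h0, zero_mul]
    · have hle := hmax l' (Finset.mem_filter.mpr ⟨hl', h0⟩)
      have hlt : weight (place s) l'.1 < weight (place s) l.1 :=
        lt_of_le_of_ne hle fun he => hne (Subtype.ext (weight_place_injective l'.2 l.2 he))
      rw [coeff_eq_zero_of_natDegree_lt ((h.mono_degree l'.1).1.trans_lt hlt), mul_zero]
  · exact fun h0 => absurd hl.1 h0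

theorem mono_rewrite (h : IsKeySequence v V γ s u c d Q) (l : ℕ →₀ ℕ) (i : ℕ) :
    (u i : F) • mono Q (l + Finsupp.single i (s i))
      = c i • mono Q (l + d i) + mono Q (l + Finsupp.single (i + 1) 1) := by
  rw [mono_add, mono_add, mono_add, mono_single, mono_single, pow_one, h.succ,
    smul_eq_C_mul, smul_eq_C_mul]
  ring

/-- Dividing `mono_rewrite` by the unit `u i` reduces every monomial to standard ones; the powers `X
^ n = Q 0 ^ n` are themselves monomials. -/
theorem span_eq_top (h : IsKeySequence v V γ s u c d Q) :
    ⊤ ≤ Submodule.span F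
      (Set.range fun l : {l : ℕ →₀ ℕ // ∀ j, l j < s j} => mono Q l.1) := by
  set S := Submodule.span F (Set.range fun l : {l : ℕ →₀ ℕ // ∀ j, l j < s j} => mono Q l.1)
  have hmono : ∀ l, mono Q l ∈ S := by
    refine radix_induction h.pos h.infinite h.digit_lt h.digit_zero
      (fun l hl => Submodule.subset_span ⟨⟨l, hl⟩, rfl⟩) fun l i h1 h2 => ?_
    rw [← inv_smul_smul (u i) (mono Q (l + Finsupp.single i (s i)))]
    have := h.mono_rewrite l i
    rw [Units.smul_def (u i), this, Units.smul_def]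
    exact S.smul_mem _ (S.add_mem (S.smul_mem _ h2) h1)
  intro f _
  rw [f.as_sum_range_C_mul_X_pow]
  refine S.sum_mem fun n _ => ?_
  have := hmono (Finsupp.single 0 n)
  rw [mono_single, h.zero] at this
  rw [← smul_eq_C_mul]
  exact S.smul_mem _ this

/-- The basis of standard monomials. -/
noncomputable def basis (h : IsKeySequence v V γ s u c d Q) :
    Basis {l : ℕ →₀ ℕ // ∀ j, l j < s j} F F[X] :=
  Basis.mk h.linearIndependent h.span_eq_top

theorem basis_apply (h : IsKeySequence v V γ s u c d Q) (l : {l : ℕ →₀ ℕ // ∀ j, l j < s j}) :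
    h.basis l = mono Q l.1 :=
  Basis.mk_apply _ _ _

/-! ### Distinctness and additivity of the values of monomials -/

theorem weight_mem {N : ℕ} {l : ℕ →₀ ℕ} (hl : ∀ j, N ≤ j → l j = 0) :
    weight γ l ∈ AddSubgroup.closure (γ '' Set.Iio N) := by
  refine sum_mem fun j hj => nsmul_mem
    (AddSubgroup.subset_closure (Set.mem_image_of_mem γ (Set.mem_Iio.mpr ?_))) _
  by_contra hjN
  exact Finsupp.mem_support_iff.mp hj (hl j (not_lt.mp hjN))

/-- Modulo `V` and the `γ j` with `j < N`, only the top digits matter; two digits below `s N` giving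
the same class coincide by minimality of `s N`. Then induct downwards. -/
theorem eq_of_weight_sub_mem (h : IsKeySequence v V γ s u c d Q) {l l' : ℕ →₀ ℕ}
    (hl : ∀ j, l j < s j) (hl' : ∀ j, l' j < s j) (hV : weight γ l - weight γ l' ∈ V) :
    l = l' := by
  obtain ⟨N, hN, hN'⟩ : ∃ N, (∀ j, N ≤ j → l j = 0) ∧ ∀ j, N ≤ j → l' j = 0 := by
    obtain ⟨N, hN⟩ := (l.support ∪ l'.support).exists_nat_subset_range
    refine ⟨N, fun j hj => ?_, fun j hj => ?_⟩ <;> by_contra h0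
    · have := Finset.mem_range.mp (hN (Finset.mem_union_left _ (Finsupp.mem_support_iff.mpr h0)))
      omega
    · have := Finset.mem_range.mp (hN (Finset.mem_union_right _ (Finsupp.mem_support_iff.mpr h0)))
      omega
  induction N generalizing l l' with
  | zero => exact Finsupp.ext fun j => (hN j (Nat.zero_le _)).trans (hN' j (Nat.zero_le _)).symm
  | succ N ih =>
    have erase_lt : ∀ {l : ℕ →₀ ℕ}, (∀ j, l j < s j) → ∀ j, (l.erase N) j < s j := by
      intro l h j
      rw [Finsupp.erase_apply]
      split_ifs
      · exact (Nat.zero_le _).trans_lt (h j)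
      · exact h j
    have erase_zero : ∀ {l : ℕ →₀ ℕ}, (∀ j, N + 1 ≤ j → l j = 0) →
        ∀ j, N ≤ j → (l.erase N) j = 0 := by
      intro l hN j hj
      rcases eq_or_ne j N with rfl | hne
      · simp
      · rw [Finsupp.erase_ne hne]; exact hN j (by omega)
    have hw := weight_eq_erase_add γ l N
    have hw' := weight_eq_erase_add γ l' N
    rw [nsmul_eq_mul] at hw hw'
    have hd : l N = l' N := by
      refine digit_unique (g := γ N) (x := weight γ l) (h.min N) (hl N) (hl' N) ?_ ?_
      · rw [hw, add_sub_cancel_right]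
        exact AddSubgroup.mem_sup_right (weight_mem (erase_zero hN))
      · have : weight γ l - l' N * γ N = (weight γ l - weight γ l') + weight γ (l'.erase N) := by
          rw [hw']; ring
        rw [this]
        exact add_mem (AddSubgroup.mem_sup_left hV)
          (AddSubgroup.mem_sup_right (weight_mem (erase_zero hN')))
    have hers := ih (erase_lt hl) (erase_lt hl') (by
      rw [hw, hw', hd, add_sub_add_right_eq_sub] at hV
      exact hV) (erase_zero hN) (erase_zero hN')
    rw [← Finsupp.erase_add_single N l, ← Finsupp.erase_add_single N l', hers, hd]

/-- The core computation, by induction along the rewriting rule: the `c i` term has the value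
predicted for the left side by `val_eq`, and the `Q (i + 1)` term is strictly larger by `val_lt`. -/
theorem basisVal_mono (h : IsKeySequence v V γ s u c d Q) (l : ℕ →₀ ℕ) :
    basisVal v h.basis (fun l => weight γ l.1) (mono Q l) = ((weight γ l : ℚ) : WithTop ℚ) := by
  induction l using radix_induction h.pos h.infinite h.digit_lt h.digit_zero with
  | hstd l hl =>
    rw [← h.basis_apply ⟨l, hl⟩, basisVal_basis]
  | hred l i h1 h2 =>
    have hu : v (u i : F) ≠ ⊤ := fun ht => by
      have h3 := h.val_lt i
      rw [ht, top_add] at h3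
      exact not_top_lt h3
    have hc : basisVal v h.basis (fun l => weight γ l.1) (c i • mono Q (l + d i))
        = v (u i : F) + ((weight γ (l + Finsupp.single i (s i)) : ℚ) : WithTop ℚ) := by
      rw [basisVal_smul, h2, weight_add, weight_add, weight_single, add_comm (weight γ l),
        WithTop.coe_add, ← add_assoc, ← h.val_eq, nsmul_eq_mul, add_comm (weight γ l),
        WithTop.coe_add, ← add_assoc]
    have hlt : basisVal v h.basis (fun l => weight γ l.1) (c i • mono Q (l + d i))
        < basisVal v h.basis (fun l => weight γ l.1) (mono Q (l + Finsupp.single (i + 1) 1)) := by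
      rw [hc, h1, weight_add, weight_add, weight_single, weight_single, one_smul,
        add_comm (weight γ l), add_comm (weight γ l), WithTop.coe_add, ← add_assoc,
        WithTop.coe_add, nsmul_eq_mul]
      exact (WithTop.add_lt_add_iff_right WithTop.coe_ne_top).mpr (h.val_lt i)
    have h3 := basisVal_add_eq_of_lt hlt
    -- The finite value of `u i` is cancelled on both sides.
    rw [← h.mono_rewrite, basisVal_smul, hc] at h3
    exact (WithTop.add_left_inj hu).mp h3

theorem isValuedBasis (h : IsKeySequence v V γ s u c d Q) :
    IsValuedBasis v h.basis fun l => weight γ l.1 where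
  eq_zero_of_eq_top := eq_zero_of_valuation_eq_top h.exists_val
  inj l l' a e ha he heq := by
    obtain ⟨g, hg, hga⟩ := h.exists_val a ha
    obtain ⟨g', hg', hge⟩ := h.exists_val e he
    rw [hga, hge] at heq
    norm_cast at heq
    refine Subtype.ext (h.eq_of_weight_sub_mem l.2 l'.2 ?_)
    have : weight γ l.1 - weight γ l'.1 = g' - g := by linarith
    rw [this]
    exact sub_mem hg' hg
  mul l l' := by
    rw [h.basis_apply, h.basis_apply, ← mono_add, h.basisVal_mono, weight_add]

/-- A key sequence determines a unique valuation of the polynomial ring. -/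
theorem exists_valuation [Nontrivial F] (h : IsKeySequence v V γ s u c d Q) :
    ∃ ν : AddValuation F[X] (WithTop ℚ), (∀ a, ν (C a) = v a) ∧
      (∀ i, ν (Q i) = ((γ i : ℚ) : WithTop ℚ)) ∧
      (∀ f, f ≠ 0 → ∃ g ∈ V ⊔ AddSubgroup.closure (Set.range γ), ν f = ((g : ℚ) : WithTop ℚ)) ∧
      ∀ μ : AddValuation F[X] (WithTop ℚ), (∀ a, μ (C a) = v a) →
        (∀ i, μ (Q i) = ((γ i : ℚ) : WithTop ℚ)) → μ = ν := by
  refine ⟨h.isValuedBasis.valuation, h.isValuedBasis.valuation_algebraMap, fun i => ?_,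
    fun f hf => ?_, fun μ hμ hμQ => h.isValuedBasis.eq_valuation μ hμ fun l => ?_⟩
  · have := h.basisVal_mono (Finsupp.single i 1)
    rwa [mono_single, pow_one, weight_single, one_smul] at this
  · obtain ⟨l, a, ha, hv⟩ := h.isValuedBasis.exists_valuation_eq hf
    obtain ⟨g, hg, hga⟩ := h.exists_val a ha
    refine ⟨g + weight γ l.1, add_mem (AddSubgroup.mem_sup_left hg)
      (AddSubgroup.mem_sup_right ?_), by rw [hv, hga, WithTop.coe_add]⟩
    exact sum_mem fun j _ => nsmul_mem (AddSubgroup.subset_closure (Set.mem_range_self j)) _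
  · rw [h.basis_apply, valuation_mono μ hμQ]

end IsKeySequence

end KeySequence

/-! ### Trivial valuations, Gauss valuations with trivial base, and fraction fields -/

section Extension

theorem exists_trivial_valuation (k : Type*) [Field k] :
    ∃ v : AddValuation k (WithTop ℚ), ∀ a, a ≠ 0 → v a = 0 := by
  classical
  refine ⟨AddValuation.of (fun a => if a = 0 then ⊤ else 0) (if_pos rfl) (if_neg one_ne_zero)
    (fun a b => ?_) fun a b => ?_, fun a ha => if_neg ha⟩
  · rcases eq_or_ne (a + b) 0 with h | h
    · simp [h]
    · have : a ≠ 0 ∨ b ≠ 0 := by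
        by_contra! h0
        exact h (by rw [h0.1, h0.2, add_zero])
      rcases this with h0 | h0 <;> simp [h, h0]
  · rcases eq_or_ne a 0 with rfl | ha <;> rcases eq_or_ne b 0 with rfl | hb <;> simp [*]

/-- The monomials form a valued basis over the trivial valuation: the weights `n * b` are distinct
because `b ≠ 0`. -/
theorem exists_polynomial_valuation (k : Type*) [Field k] {b : ℚ} (hb : b ≠ 0) :
    ∃ v : AddValuation k[X] (WithTop ℚ), (∀ a, a ≠ 0 → v (C a) = 0) ∧
      v X = ((b : ℚ) : WithTop ℚ) ∧
      (∀ f, f ≠ 0 → ∃ g ∈ AddSubgroup.zmultiples b, v f = ((g : ℚ) : WithTop ℚ)) ∧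
      ∀ μ : AddValuation k[X] (WithTop ℚ), (∀ a, a ≠ 0 → μ (C a) = 0) →
        μ X = ((b : ℚ) : WithTop ℚ) → μ = v := by
  obtain ⟨v₀, hv₀⟩ := exists_trivial_valuation k
  have h : IsValuedBasis v₀ (Polynomial.basisMonomials k) fun n => n * b :=
    { eq_zero_of_eq_top := fun a ha => by
        by_contra h0
        rw [hv₀ a h0] at ha
        exact WithTop.zero_ne_top ha
      inj := fun i j a c ha hc he => by
        rw [hv₀ a ha, hv₀ c hc, zero_add, zero_add, WithTop.coe_inj] at he
        exact_mod_cast mul_right_cancel₀ hb he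
      mul := fun i j => by
        have : basisMonomials k i * basisMonomials k j = basisMonomials k (i + j) := by
          simp [monomial_mul_monomial]
        rw [this, basisVal_basis]
        rw [WithTop.coe_inj, Nat.cast_add, add_mul] }
  refine ⟨h.valuation, fun a ha => ?_, ?_, fun f hf => ?_, fun μ hμ hμX => ?_⟩
  · exact (h.valuation_algebraMap a).trans (hv₀ a ha)
  · simpa [monomial_one_one_eq_X] using h.valuation_basis 1
  · obtain ⟨n, a, ha, hv⟩ := h.exists_valuation_eq hf
    refine ⟨n * b, ⟨n, by simp⟩, ?_⟩
    rw [hv, hv₀ a ha, zero_add]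
  · refine h.eq_valuation μ (fun a => ?_) fun n => ?_
    · rcases eq_or_ne a 0 with rfl | ha
      · simp
      · rw [hv₀ a ha]; exact hμ a ha
    · rw [coe_basisMonomials]
      change μ (monomial n 1) = _
      rw [monomial_one_right_eq_X_pow, μ.map_pow, hμX, ← WithTop.coe_nsmul,
        nsmul_eq_mul]

variable {A K : Type*} [CommRing A] [IsDomain A] [Field K] [Algebra A K] [IsFractionRing A K]

theorem exists_fraction_valuation (v : AddValuation A (WithTop ℚ)) (hv : ∀ a, v a = ⊤ → a = 0) :
    ∃ ν : AddValuation K (WithTop ℚ), ∀ a, ν (algebraMap A K a) = v a := by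
  have hS : nonZeroDivisors A ≤ (AddValuation.toValuation v).supp.primeCompl := by
    intro a ha h
    exact nonZeroDivisors.ne_zero ha (hv a h)
  exact ⟨AddValuation.ofValuation ((AddValuation.toValuation v).extendToLocalization hS K),
    fun a => Valuation.extendToLocalization_apply_map_apply _ hS K a⟩

theorem valuation_div_algebraMap (ν : AddValuation K (WithTop ℚ)) (a b : A) (hb : b ≠ 0) :
    ν (algebraMap A K a / algebraMap A K b) + ν (algebraMap A K b) = ν (algebraMap A K a) := by
  rw [← ν.map_mul, div_mul_cancel₀]
  exact IsFractionRing.to_map_ne_zero_of_mem_nonZeroDivisors (mem_nonZeroDivisors_of_ne_zero hb)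

theorem valuation_ne_top {ν : AddValuation K (WithTop ℚ)} {x : K} (hx : x ≠ 0) : ν x ≠ ⊤ :=
  fun h => hx (ν.top_iff.mp h)

theorem fraction_valuation_ext (A : Type*) [CommRing A] [IsDomain A] [Algebra A K]
    [IsFractionRing A K] {μ ν : AddValuation K (WithTop ℚ)}
    (h : ∀ a, μ (algebraMap A K a) = ν (algebraMap A K a)) : μ = ν := by
  ext x
  obtain ⟨a, b, hb, rfl⟩ := IsFractionRing.div_surjective (A := A) x
  have hb0 := nonZeroDivisors.ne_zero hb
  have h1 := valuation_div_algebraMap μ a b hb0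
  have h2 := valuation_div_algebraMap ν a b hb0
  rw [h a, h b, ← h2] at h1
  refine (WithTop.add_right_inj (valuation_ne_top (ν := ν) ?_)).mp h1
  exact IsFractionRing.to_map_ne_zero_of_mem_nonZeroDivisors hb

theorem exists_mem_fraction_valuation {v : AddValuation A (WithTop ℚ)} {V : AddSubgroup ℚ}
    (hV : ∀ a, a ≠ 0 → ∃ g ∈ V, v a = ((g : ℚ) : WithTop ℚ)) {ν : AddValuation K (WithTop ℚ)}
    (hν : ∀ a, ν (algebraMap A K a) = v a) (x : K) (hx : x ≠ 0) :
    ∃ g ∈ V, ν x = ((g : ℚ) : WithTop ℚ) := by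
  obtain ⟨a, b, hb, rfl⟩ := IsFractionRing.div_surjective (A := A) x
  have hb0 := nonZeroDivisors.ne_zero hb
  have ha0 : a ≠ 0 := by
    rintro rfl
    simp at hx
  have h1 := valuation_div_algebraMap ν a b hb0
  obtain ⟨g, hg, hga⟩ := hV a ha0
  obtain ⟨e, he, heb⟩ := hV b hb0
  refine ⟨g - e, sub_mem hg he, ?_⟩
  rw [hν, hν, hga, heb] at h1
  refine (WithTop.add_right_inj (WithTop.coe_ne_top (a := e))).mp ?_
  rw [h1, ← WithTop.coe_add, sub_add_cancel]

end Extension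

/-! ### Domination of the local ring at the origin -/

section Dominates

open MvPolynomial

variable {k : Type*} [Field k]

/-- Both `a` and `a⁻¹` lie in the local ring, so their values are nonnegative with sum zero. -/
theorem Dominates.valuation_C {ν : AddValuation (RatFun k) (WithTop ℚ)}
    (h : Dominates ν (localRing k)) {a : k} (ha : a ≠ 0) :
    ν (algebraMap (MvPolynomial (Fin 3) k) (RatFun k) (MvPolynomial.C a)) = 0 := by
  have h0 : ∀ c : k, 0 ≤ ν (algebraMap (MvPolynomial (Fin 3) k) (RatFun k) (MvPolynomial.C c)) :=
    fun c => h.1 (algebraMap (MvPolynomial (Fin 3) k) (localRing k) (MvPolynomial.C c))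
  have h1 : ν (algebraMap (MvPolynomial (Fin 3) k) (RatFun k) (MvPolynomial.C a))
      + ν (algebraMap (MvPolynomial (Fin 3) k) (RatFun k) (MvPolynomial.C a⁻¹)) = 0 := by
    rw [← ν.map_mul, ← map_mul, ← MvPolynomial.C_mul, mul_inv_cancel₀ ha]
    simp
  exact le_antisymm ((le_add_of_nonneg_right (h0 a⁻¹)).trans h1.le) (h0 a)

/-- A polynomial outside the origin ideal is a nonzero constant plus an element of positive value,
so it has value zero. A fraction in the local ring thus has the value of its numerator. -/
theorem dominates_localRing {ν : AddValuation (RatFun k) (WithTop ℚ)}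
    (hk : ∀ a : k, a ≠ 0 →
      ν (algebraMap (MvPolynomial (Fin 3) k) (RatFun k) (MvPolynomial.C a)) = 0)
    (hX : ∀ i, 0 < ν (algebraMap (MvPolynomial (Fin 3) k) (RatFun k) (MvPolynomial.X i))) :
    Dominates ν (localRing k) := by
  set φ := algebraMap (MvPolynomial (Fin 3) k) (RatFun k) with hφ
  have hC : ∀ a, 0 ≤ ν (φ (MvPolynomial.C a)) := fun a => by
    rcases eq_or_ne a 0 with rfl | ha
    · simp
    · exact (hk a ha).ge
  have hnn : ∀ f, 0 ≤ ν (φ f) := fun f => by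
    induction f using MvPolynomial.induction_on with
    | C a => exact hC a
    | add f g hf hg => rw [map_add]; exact (le_min hf hg).trans (ν.map_add _ _)
    | mul_X f i hf => rw [map_mul, ν.map_mul]; exact add_nonneg hf (hX i).le
  have hpos : ∀ f ∈ originIdeal k, 0 < ν (φ f) := fun f hf => by
    rw [originIdeal] at hf
    induction hf using Submodule.span_induction with
    | mem f hf =>
      simp only [Set.mem_insert_iff, Set.mem_singleton_iff] at hf
      rcases hf with rfl | rfl | rfl <;> exact hX _
    | zero => simp
    | add f g _ _ hf hg => rw [map_add]; exact (lt_min hf hg).trans_le (ν.map_add _ _)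
    | smul a f _ hf =>
      rw [smul_eq_mul, map_mul, ν.map_mul]
      exact hf.trans_le (le_add_of_nonneg_left (hnn a))
  have hzero : ∀ f ∉ originIdeal k, ν (φ f) = 0 := fun f hf => by
    have hc : constantCoeff f ≠ 0 := by rwa [originIdeal_eq_ker, RingHom.mem_ker] at hf
    have hm : f - MvPolynomial.C (constantCoeff f) ∈ originIdeal k := by
      rw [originIdeal_eq_ker, RingHom.mem_ker]; simp
    have h1 := hk _ hc
    have h2 := ν.map_add_eq_of_lt_left (h1.trans_lt (hpos _ hm))
    rwa [← map_add, add_sub_cancel, h1] at h2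
  have key : ∀ f : localRing k, ∃ (a : MvPolynomial (Fin 3) k) (b : (originIdeal k).primeCompl),
      ν (f : RatFun k) = ν (φ a) ∧ f = IsLocalization.mk' (localRing k) a b := by
    intro f
    obtain ⟨a, b, rfl⟩ := IsLocalization.exists_mk'_eq (originIdeal k).primeCompl f
    refine ⟨a, b, ?_, rfl⟩
    have h1 := congrArg (fun g : localRing k => ν (g : RatFun k))
      (IsLocalization.mk'_spec (localRing k) a b)
    have h2 : ν (((IsLocalization.mk' (localRing k) a b : localRing k) : RatFun k) * φ b)
      = ν (φ a) := h1
    rwa [ν.map_mul, hzero b b.2, add_zero] at h2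
  refine ⟨fun f => ?_, fun f => ?_⟩
  · obtain ⟨a, b, h, -⟩ := key f
    rw [h]; exact hnn a
  · obtain ⟨a, b, h, rfl⟩ := key f
    rw [h, IsLocalization.AtPrime.mk'_mem_maximal_iff (localRing k) (originIdeal k)]
    refine ⟨fun h0 => ?_, hpos a⟩
    by_contra ha
    exact h0.ne' (hzero a ha)

end Dominates

/-! ### The polynomial ring in three variables as an iterated polynomial ring -/

section Tower

variable (k : Type*) [Field k]

/-- The field `k(x, y)`. -/
abbrev RatFunTwo : Type _ := FractionRing k[X][X]

/-- The inclusion `k[x][y] → k[x, y, z]`. -/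
noncomputable def toMv : k[X][X] →+* MvPolynomial (Fin 3) k :=
  eval₂RingHom (eval₂RingHom MvPolynomial.C (MvPolynomial.X 0)) (MvPolynomial.X 1)

/-- The reduction `k[x, y, z] → k[x][y]` modulo `z`. -/
noncomputable def ofMv : MvPolynomial (Fin 3) k →+* k[X][X] :=
  MvPolynomial.eval₂Hom (C.comp C) ![C X, X, 0]

/-- The inclusion `k[x, y, z] → k(x, y)[z]`. -/
noncomputable def toTower : MvPolynomial (Fin 3) k →+* (RatFunTwo k)[X] :=
  MvPolynomial.eval₂Hom ((C.comp (algebraMap k[X][X] (RatFunTwo k))).comp (C.comp C))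
    ![C (algebraMap k[X][X] (RatFunTwo k) (C X)), C (algebraMap k[X][X] (RatFunTwo k) X), X]

variable {k}

theorem ofMv_toMv (f : k[X][X]) : ofMv k (toMv k f) = f := by
  have : (ofMv k).comp (toMv k) = RingHom.id _ := by
    ext <;> simp [ofMv, toMv]
  exact congrArg (fun g => g f) this

theorem toTower_toMv (f : k[X][X]) :
    toTower k (toMv k f) = C (algebraMap k[X][X] (RatFunTwo k) f) := by
  have : (toTower k).comp (toMv k) = C.comp (algebraMap k[X][X] (RatFunTwo k)) := by
    ext <;> simp [toTower, toMv]
  exact congrArg (fun g => g f) this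

theorem toMv_injective : Function.Injective (toMv k) :=
  Function.LeftInverse.injective ofMv_toMv

theorem algebraMap_comp_toMv_injective :
    Function.Injective ((algebraMap (MvPolynomial (Fin 3) k) (RatFun k)).comp (toMv k)) :=
  (IsFractionRing.injective (MvPolynomial (Fin 3) k) (RatFun k)).comp toMv_injective

variable (k) in
/-- The inclusion `k(x, y)[z] → k(x, y, z)`. -/
noncomputable def ofTower : (RatFunTwo k)[X] →+* RatFun k :=
  eval₂RingHom (IsFractionRing.lift (algebraMap_comp_toMv_injective (k := k)))
    (algebraMap (MvPolynomial (Fin 3) k) (RatFun k) (MvPolynomial.X 2))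

/-- This compatibility yields injectivity of `toTower` and lets valuations of `k(x,y,z)` be compared
with those of `k(x,y)[z]`. -/
theorem ofTower_toTower (f : MvPolynomial (Fin 3) k) :
    ofTower k (toTower k f) = algebraMap (MvPolynomial (Fin 3) k) (RatFun k) f := by
  have : (ofTower k).comp (toTower k) = algebraMap (MvPolynomial (Fin 3) k) (RatFun k) := by
    refine MvPolynomial.ringHom_ext (fun a => ?_) fun i => ?_
    · simp [ofTower, toTower, toMv]
    · fin_cases i <;> simp [ofTower, toTower, toMv]
  exact congrArg (fun g => g f) this

theorem toTower_injective : Function.Injective (toTower k) := by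
  intro f g h
  have := congrArg (ofTower k) h
  rw [ofTower_toTower, ofTower_toTower] at this
  exact IsFractionRing.injective _ _ this

/-- The `P i` do not involve `z`, so setting `z = 0` loses nothing; in the tower they become scalars
for the `Q`-step. -/
theorem toMv_ofMv_P (β : ℕ → ℚ) (lam : ℕ → k) (i : ℕ) :
    toMv k (ofMv k (P β lam i)) = P β lam i := by
  induction i using Nat.strong_induction_on with | _ i ih
  match i with
  | 0 => rw [P]; simp [toMv, ofMv]
  | 1 => rw [P]; simp [toMv, ofMv]
  | i + 2 =>
    have hC : toMv k (ofMv k (MvPolynomial.C (lam (i + 1)))) = MvPolynomial.C (lam (i + 1)) := by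
      simp [toMv, ofMv]
    rw [P]
    simp only [map_sub, map_mul, map_pow, map_prod, hC]
    rw [ih (i + 1) (by omega)]
    congr 2
    exact Finset.prod_congr rfl fun j _ => by rw [ih j (by omega)]

theorem toTower_P (β : ℕ → ℚ) (lam : ℕ → k) (i : ℕ) :
    toTower k (P β lam i) = C (algebraMap k[X][X] (RatFunTwo k) (ofMv k (P β lam i))) := by
  rw [← toTower_toMv, toMv_ofMv_P]

theorem toTower_C (a : k) :
    toTower k (MvPolynomial.C a) = C (algebraMap k[X][X] (RatFunTwo k) (C (C a))) := by
  simp [toTower]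

end Tower

/-! ### Digits -/

section Digits

/-- The exponent vector `(f 1, …, f i, 0, 0, …)`. -/
noncomputable def digits (f : ℕ → ℕ) (i : ℕ) : ℕ →₀ ℕ :=
  Finsupp.onFinset (Finset.range i) (fun j => if j < i then f (j + 1) else 0) fun j hj => by
    by_contra h
    rw [Finset.mem_range] at h
    exact hj (if_neg h)

theorem digits_apply (f : ℕ → ℕ) (i j : ℕ) : digits f i j = if j < i then f (j + 1) else 0 := rfl

theorem mono_digits {A : Type*} [CommRing A] (Q : ℕ → A) (f : ℕ → ℕ) (i : ℕ) :
    mono Q (digits f i) = ∏ j ∈ Finset.range i, Q j ^ f (j + 1) := by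
  rw [mono, digits, Finsupp.onFinset_prod _ fun j => pow_zero _]
  exact Finset.prod_congr rfl fun j hj => by rw [if_pos (Finset.mem_range.mp hj)]

theorem sum_range_succ_eq_sum_Icc (f : ℕ → ℚ) (i : ℕ) :
    ∑ j ∈ Finset.range i, f (j + 1) = ∑ j ∈ Finset.Icc 1 i, f j := by
  rw [Finset.range_eq_Ico, Finset.sum_Ico_add' f 0 i 1]
  rfl

theorem weight_digits (γ : ℕ → ℚ) (f : ℕ → ℕ) (i : ℕ) :
    weight (fun j => γ (j + 1)) (digits f i) = ∑ j ∈ Finset.Icc 1 i, (f j : ℚ) * γ j := by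
  rw [weight, digits, Finsupp.onFinset_sum (g := fun j n => n • γ (j + 1)) _ fun j => zero_nsmul _,
    ← sum_range_succ_eq_sum_Icc fun j => (f j : ℚ) * γ j]
  exact Finset.sum_congr rfl fun j hj => by
    rw [if_pos (Finset.mem_range.mp hj), nsmul_eq_mul]

theorem image_succ_Iio (γ : ℕ → ℚ) (i : ℕ) :
    (fun j => γ (j + 1)) '' Set.Iio i = γ '' Set.Icc 1 i := by
  ext x
  constructor
  · rintro ⟨j, hj, rfl⟩
    exact ⟨j + 1, ⟨by omega, by simpa [Nat.succ_le_iff] using hj⟩, rfl⟩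
  · rintro ⟨j, ⟨h1, h2⟩, rfl⟩
    exact ⟨j - 1, by simp only [Set.mem_Iio]; omega, by simp only [Nat.sub_add_cancel h1]⟩

theorem infinite_shift {p : ℕ → Prop} (h : {i | 1 ≤ i ∧ p i}.Infinite) :
    {i | p (i + 1)}.Infinite := by
  refine Set.Infinite.of_image (· + 1) (h.mono ?_)
  rintro i ⟨hi, hp⟩
  exact ⟨i - 1, by simpa [Nat.sub_add_cancel hi] using hp, Nat.sub_add_cancel hi⟩

end Digits

theorem valuation_prod_pow {A ι : Type*} [CommRing A] (μ : AddValuation A (WithTop ℚ))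
    {f : ι → A} {w : ι → ℚ} (h : ∀ i, μ (f i) = ((w i : ℚ) : WithTop ℚ)) (t : Finset ι)
    (n : ι → ℕ) : μ (∏ i ∈ t, f i ^ n i) = ((∑ i ∈ t, (n i : ℚ) * w i : ℚ) : WithTop ℚ) := by
  classical
  induction t using Finset.induction_on with
  | empty => simp
  | insert a t ha ih =>
    rw [Finset.prod_insert ha, Finset.sum_insert ha, μ.map_mul, μ.map_pow, h, ih,
      WithTop.coe_add, ← WithTop.coe_nsmul, nsmul_eq_mul]

/-! ### The two key sequences -/

section KeySequences

variable {k : Type*} [Field k] {β γ : ℕ → ℚ} {lam mu : ℕ → k}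

/-- Over `k[x]` the power of `x` is absorbed into the coefficient `c i`. The leading units are `1`,
which suffices because `n_{i,0}` is positive. -/
theorem isKeySequence_P (hβpos : ∀ i, 0 < β i) (hlam : ∀ i, 1 ≤ i → lam i ≠ 0)
    (hβ : ∀ i, 1 ≤ i → (q β i : ℚ) * β i < β (i + 1)) (hq : {i : ℕ | 1 ≤ i ∧ 1 < q β i}.Infinite)
    {v : AddValuation k[X] (WithTop ℚ)} (hvC : ∀ a, a ≠ 0 → v (C a) = 0)
    (hvX : v X = ((β 0 : ℚ) : WithTop ℚ))
    (hv : ∀ f, f ≠ 0 → ∃ g ∈ AddSubgroup.zmultiples (β 0), v f = ((g : ℚ) : WithTop ℚ)) :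
    IsKeySequence v (AddSubgroup.zmultiples (β 0)) (fun i => β (i + 1)) (fun i => q β (i + 1))
      (fun _ => 1) (fun i => C (lam (i + 1)) * X ^ nP β (i + 1) 0)
      (fun i => digits (betaExp β (i + 1)).2 i) (fun i => ofMv k (P β lam (i + 1))) where
  exists_val := hv
  zero := by rw [P]; simp [ofMv]
  succ i := by
    have hx : ofMv k (P β lam 0) = C X := by rw [P]; simp [ofMv]
    have hC : ofMv k (MvPolynomial.C (lam (i + 1))) = C (C (lam (i + 1))) := by simp [ofMv]
    have hn : ∀ j, nP β (i + 1) (j + 1) = (betaExp β (i + 1)).2 (j + 1) := fun j => if_neg (by simp)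
    rw [P_succ β lam (i := i + 1) (by omega), Finset.prod_range_succ', mono_digits]
    simp only [map_sub, map_mul, map_pow, map_prod, hx, hC, hn, Units.val_one, map_one, one_mul]
    ring
  pos i := (q_spec (hβpos 0).ne' (i + 1)).1
  infinite := infinite_shift hq
  min i n hn h := by
    refine q_min hn ?_
    rw [image_succ_Iio] at h
    refine (sup_le ?_ ?_ : _ ≤ G β (i + 1 - 1)) h
    · rw [AddSubgroup.zmultiples_le]
      exact beta_mem_G (Nat.zero_le _)
    · exact AddSubgroup.closure_mono (Set.image_mono fun j hj => hj.2)
  digit_lt i j := by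
    rw [digits_apply]
    split_ifs with hj
    · exact (betaExp_spec (hβpos 0).ne' (i + 1)).lt _ (by rw [Finset.mem_Icc]; omega)
    · exact (q_spec (hβpos 0).ne' (j + 1)).1
  digit_zero i j hij := by rw [digits_apply, if_neg (by omega)]
  val_eq i := by
    -- Positivity of `n_{i,0}` ensures that `toNat` does not change it.
    have h0 := betaExp_pos hβpos hβ (i := i + 1) (by omega)
    have h1 : ((nP β (i + 1) 0 : ℕ) : ℚ) = ((betaExp β (i + 1)).1 : ℚ) := by
      have : ((nP β (i + 1) 0 : ℕ) : ℤ) = (betaExp β (i + 1)).1 := Int.toNat_of_nonneg h0.le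
      exact_mod_cast this
    rw [Units.val_one, AddValuation.map_one, zero_add, v.map_mul, hvC _ (hlam _ (by omega)),
      zero_add, v.map_pow, hvX, weight_digits, ← WithTop.coe_nsmul, ← WithTop.coe_add,
      WithTop.coe_inj, nsmul_eq_mul, h1]
    exact (betaExp_spec (hβpos 0).ne' (i + 1)).eq
  val_lt i := by
    rw [Units.val_one, AddValuation.map_one, zero_add, WithTop.coe_lt_coe]
    exact hβ (i + 1) (by omega)

theorem algebraMap_C_X_ne_zero : algebraMap k[X][X] (RatFunTwo k) (C X) ≠ 0 := by
  rw [Ne, IsFractionRing.to_map_eq_zero_iff]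
  simp

theorem valuation_x {v : AddValuation (RatFunTwo k) (WithTop ℚ)}
    (hvP : ∀ i, v (algebraMap k[X][X] (RatFunTwo k) (ofMv k (P β lam i)))
      = ((β i : ℚ) : WithTop ℚ)) :
    v (algebraMap k[X][X] (RatFunTwo k) (C X)) = ((β 0 : ℚ) : WithTop ℚ) := by
  have := hvP 0
  rw [P] at this
  simpa [ofMv] using this

/-- Passing to `k(x,y)` turns `x ^ r_{i,0}` into a unit and the product of the `P j` into a scalar.
The value group is `GInf β` because `s` is minimal relative to `H + G`. -/
theorem isKeySequence_Q (hβpos : ∀ i, 0 < β i) (hmu : ∀ i, 1 ≤ i → mu i ≠ 0)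
    (hγ : ∀ i, 1 ≤ i → (r β γ i : ℚ) * β 0 + (s β γ i : ℚ) * γ i < γ (i + 1))
    (hs : {i : ℕ | 1 ≤ i ∧ 1 < s β γ i}.Infinite)
    {v : AddValuation (RatFunTwo k) (WithTop ℚ)}
    (hvC : ∀ a, a ≠ 0 → v (algebraMap k[X][X] (RatFunTwo k) (C (C a))) = 0)
    (hvP : ∀ i, v (algebraMap k[X][X] (RatFunTwo k) (ofMv k (P β lam i)))
      = ((β i : ℚ) : WithTop ℚ))
    (hv : ∀ f, f ≠ 0 → ∃ g ∈ GInf β, v f = ((g : ℚ) : WithTop ℚ)) :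
    IsKeySequence v (GInf β) (fun i => γ (i + 1)) (fun i => s β γ (i + 1))
      (fun i => Units.mk0 _ algebraMap_C_X_ne_zero ^ r β γ (i + 1))
      (fun i => algebraMap k[X][X] (RatFunTwo k) (C (C (mu (i + 1)))
        * ∏ j ∈ Finset.range (m β γ (i + 1) + 1), ofMv k (P β lam j) ^ nQ β γ (i + 1) j))
      (fun i => digits (lQ β γ (i + 1)) i) (fun i => toTower k (Q β γ lam mu (i + 1))) where
  exists_val := hv
  zero := by rw [Q]; simp [toTower]
  succ i := by
    have hx : toTower k (MvPolynomial.X 0) = C (algebraMap k[X][X] (RatFunTwo k) (C X)) := by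
      simp [toTower]
    rw [Q, mono_digits,
      Finset.prod_range fun j => toTower k (Q β γ lam mu (j + 1)) ^ lQ β γ (i + 1) (j + 1)]
    simp only [map_sub, map_mul, map_pow, map_prod, hx, toTower_C, toTower_P, Units.val_pow_eq_pow_val,
      Units.val_mk0]
  pos i := (s_spec (hβpos 0).ne' (i + 1)).1
  infinite := infinite_shift hs
  min i n hn h := by
    refine s_min hn ?_
    rw [image_succ_Iio, sup_comm] at h
    exact h
  digit_lt i j := by
    rw [digits_apply]
    split_ifs with hj
    · exact (gammaExp_spec (hβpos 0).ne' (i := i + 1) (by omega)).llt _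
        (by rw [Finset.mem_Icc]; omega)
    · exact (s_spec (hβpos 0).ne' (j + 1)).1
  digit_zero i j hij := by rw [digits_apply, if_neg (by omega)]
  val_eq i := by
    rw [Units.val_pow_eq_pow_val, Units.val_mk0, v.map_pow, valuation_x hvP, map_mul, v.map_mul,
      hvC _ (hmu _ (by omega)), zero_add, weight_digits, map_prod]
    simp only [map_pow]
    rw [valuation_prod_pow v hvP, ← WithTop.coe_nsmul, ← WithTop.coe_add, ← WithTop.coe_add,
      WithTop.coe_inj, nsmul_eq_mul, Finset.sum_range_succ',
      sum_range_succ_eq_sum_Icc fun j => (nQ β γ (i + 1) j : ℚ) * β j]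
    have h := (gammaExp_spec (γ := γ) (hβpos 0).ne' (i := i + 1) (by omega)).eq
    have hsum : ∑ j ∈ Finset.Icc 1 (m β γ (i + 1)), (nQ β γ (i + 1) j : ℚ) * β j
        = ∑ j ∈ Finset.Icc 1 (m β γ (i + 1)), ((gammaExp β γ (i + 1)).2.1 j : ℚ) * β j :=
      Finset.sum_congr rfl fun j hj => by
        rw [nQ, if_neg (by rw [Finset.mem_Icc] at hj; omega)]
    -- The identity `max(0, a) - max(0, -a) = a`: the negative part of `a_i` was moved to the other
    -- side as `x ^ r_{i,0}`.
    have ha : ((nQ β γ (i + 1) 0 : ℕ) : ℚ) - (r β γ (i + 1) : ℕ)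
        = ((gammaExp β γ (i + 1)).1 : ℚ) := by
      have : ((nQ β γ (i + 1) 0 : ℕ) : ℤ) - (r β γ (i + 1) : ℕ) = (gammaExp β γ (i + 1)).1 :=
        Int.toNat_sub_toNat_neg _
      exact_mod_cast this
    rw [hsum, h, ← ha]
    simp only [Nat.add_sub_cancel, lQ]
    ring
  val_lt i := by
    rw [Units.val_pow_eq_pow_val, Units.val_mk0, v.map_pow, valuation_x hvP, ← WithTop.coe_nsmul,
      ← WithTop.coe_add, WithTop.coe_lt_coe, nsmul_eq_mul]
    exact hγ (i + 1) (by omega)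

end KeySequences

/-! ### The valuation of `k(x, y)[z]` -/

section TowerValuation

variable {k : Type*} [Field k] {β γ : ℕ → ℚ} {lam mu : ℕ → k}

theorem sup_closure_le_GInf (β : ℕ → ℚ) :
    AddSubgroup.zmultiples (β 0) ⊔ AddSubgroup.closure (Set.range fun i => β (i + 1))
      ≤ GInf β := by
  refine sup_le ?_ (AddSubgroup.closure_mono ?_)
  · rw [AddSubgroup.zmultiples_le]
    exact AddSubgroup.subset_closure ⟨0, rfl⟩
  · rintro _ ⟨i, rfl⟩
    exact ⟨i + 1, rfl⟩

theorem exists_tower_valuation (hβpos : ∀ i, 0 < β i)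
    (hlam : ∀ i, 1 ≤ i → lam i ≠ 0) (hmu : ∀ i, 1 ≤ i → mu i ≠ 0)
    (hβ : ∀ i, 1 ≤ i → (q β i : ℚ) * β i < β (i + 1))
    (hγ : ∀ i, 1 ≤ i → (r β γ i : ℚ) * β 0 + (s β γ i : ℚ) * γ i < γ (i + 1))
    (hq : {i : ℕ | 1 ≤ i ∧ 1 < q β i}.Infinite)
    (hs : {i : ℕ | 1 ≤ i ∧ 1 < s β γ i}.Infinite) :
    ∃ ν : AddValuation (RatFunTwo k)[X] (WithTop ℚ), (∀ f, ν f = ⊤ → f = 0) ∧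
      (∀ a, a ≠ 0 → ν (toTower k (MvPolynomial.C a)) = 0) ∧
      (∀ i, ν (toTower k (P β lam i)) = ((β i : ℚ) : WithTop ℚ)) ∧
      (∀ i, 1 ≤ i → ν (toTower k (Q β γ lam mu i)) = ((γ i : ℚ) : WithTop ℚ)) ∧
      ∀ μ : AddValuation (RatFunTwo k)[X] (WithTop ℚ),
        (∀ a, a ≠ 0 → μ (toTower k (MvPolynomial.C a)) = 0) →
        (∀ i, μ (toTower k (P β lam i)) = ((β i : ℚ) : WithTop ℚ)) →
        (∀ i, 1 ≤ i → μ (toTower k (Q β γ lam mu i)) = ((γ i : ℚ) : WithTop ℚ)) → μ = ν := by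
  have hP0 : ofMv k (P β lam 0) = C X := by rw [P]; simp [ofMv]
  obtain ⟨v₁, hC₁, hX₁, hV₁, huniq₁⟩ := exists_polynomial_valuation k (hβpos 0).ne'
  obtain ⟨v₂, hC₂, hP₂, hV₂, huniq₂⟩ :=
    (isKeySequence_P hβpos hlam hβ hq hC₁ hX₁ hV₁).exists_valuation
  have hP₂' : ∀ i, v₂ (ofMv k (P β lam i)) = ((β i : ℚ) : WithTop ℚ) := by
    rintro (_ | i)
    · rw [hP0, hC₂, hX₁]
    · exact hP₂ i
  replace hV₂ : ∀ f, f ≠ 0 → ∃ g ∈ GInf β, v₂ f = ((g : ℚ) : WithTop ℚ) := fun f hf => by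
    obtain ⟨g, hg, h⟩ := hV₂ f hf
    exact ⟨g, sup_closure_le_GInf β hg, h⟩
  obtain ⟨v, hv⟩ := exists_fraction_valuation (K := RatFunTwo k) v₂
    (eq_zero_of_valuation_eq_top hV₂)
  obtain ⟨ν, hC, hQ, hV, huniq⟩ := (isKeySequence_Q (γ := γ) (lam := lam) hβpos hmu hγ hs
    (fun a ha => by rw [hv, hC₂, hC₁ a ha]) (fun i => by rw [hv, hP₂'])
    (exists_mem_fraction_valuation hV₂ hv)).exists_valuation
  refine ⟨ν, eq_zero_of_valuation_eq_top hV, fun a ha => ?_, fun i => ?_, fun i hi => ?_,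
    fun μ hμC hμP hμQ => huniq μ (fun a => ?_) fun i => hμQ (i + 1) (by omega)⟩
  · rw [toTower_C, hC, hv, hC₂, hC₁ a ha]
  · rw [toTower_P, hC, hv, hP₂']
  · obtain ⟨i, rfl⟩ : ∃ j, i = j + 1 := ⟨i - 1, by omega⟩
    exact hQ i
  · have h₁ : ((μ.comap C).comap (algebraMap k[X][X] (RatFunTwo k))).comap C = v₁ := by
      refine huniq₁ _ (fun a ha => ?_) ?_
      · rw [← hμC a ha, toTower_C]; rfl
      · rw [← hμP 0, toTower_P, hP0]; rfl
    have h₂ : (μ.comap C).comap (algebraMap k[X][X] (RatFunTwo k)) = v₂ := by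
      refine huniq₂ _ (fun a => by rw [← h₁]; rfl) fun i => ?_
      rw [← hμP (i + 1), toTower_P]; rfl
    have h : μ.comap C = v := by
      refine fraction_valuation_ext k[X][X] fun a => ?_
      rw [hv, ← h₂]; rfl
    rw [← h]; rfl

end TowerValuation

end DefSeq

/-! ### Passage from `k(x,y)[z]` to `k(x,y,z)` -/

theorem theorem5p1 {k : Type*} [Field k]
    (β γ : ℕ → ℚ) (lam mu : ℕ → k)
    (hβpos : ∀ i, 0 < β i) (hγpos : ∀ i, 1 ≤ i → 0 < γ i)
    (hlam : ∀ i, 1 ≤ i → lam i ≠ 0) (hmu : ∀ i, 1 ≤ i → mu i ≠ 0)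
    (hβ : ∀ i, 1 ≤ i → (DefSeq.q β i : ℚ) * β i < β (i + 1))
    (hγ : ∀ i, 1 ≤ i →
      (DefSeq.r β γ i : ℚ) * β 0 + (DefSeq.s β γ i : ℚ) * γ i < γ (i + 1))
    (hq : {i : ℕ | 1 ≤ i ∧ 1 < DefSeq.q β i}.Infinite)
    (hs : {i : ℕ | 1 ≤ i ∧ 1 < DefSeq.s β γ i}.Infinite) :
    ∃! ν : AddValuation (DefSeq.RatFun k) (WithTop ℚ),
      DefSeq.Dominates ν (DefSeq.localRing k) ∧
      (∀ i, ν (algebraMap (MvPolynomial (Fin 3) k) (DefSeq.RatFun k) (DefSeq.P β lam i))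
        = ((β i : ℚ) : WithTop ℚ)) ∧
      (∀ i, 1 ≤ i →
        ν (algebraMap (MvPolynomial (Fin 3) k) (DefSeq.RatFun k) (DefSeq.Q β γ lam mu i))
          = ((γ i : ℚ) : WithTop ℚ)) := by
  obtain ⟨ν₀, htop, hC, hP, hQ, huniq⟩ :=
    DefSeq.exists_tower_valuation hβpos hlam hmu hβ hγ hq hs
  obtain ⟨ν, hν⟩ := DefSeq.exists_fraction_valuation (K := DefSeq.RatFun k)
    (ν₀.comap (DefSeq.toTower k)) fun f hf =>
      DefSeq.toTower_injective ((htop _ hf).trans (map_zero _).symm)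
  have hν' : ∀ f, ν (algebraMap (MvPolynomial (Fin 3) k) (DefSeq.RatFun k) f)
      = ν₀ (DefSeq.toTower k f) := hν
  refine ⟨ν, ⟨DefSeq.dominates_localRing (fun a ha => by rw [hν', hC a ha]) fun i => ?_,
    fun i => by rw [hν', hP], fun i hi => by rw [hν', hQ i hi]⟩, ?_⟩
  · rw [hν']
    -- The variables are `P 0`, `P 1` and `Q 1`, so their values are prescribed and positive.
    have h0 := hP 0
    have h1 := hP 1
    have h2 := hQ 1 le_rfl
    rw [DefSeq.P] at h0
    rw [DefSeq.P] at h1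
    rw [DefSeq.Q] at h2
    match i with
    | 0 => rw [h0]; exact_mod_cast hβpos 0
    | 1 => rw [h1]; exact_mod_cast hβpos 1
    | 2 => rw [h2]; exact_mod_cast hγpos 1 le_rfl
  · rintro μ ⟨hdom, hμP, hμQ⟩
    -- A competing valuation is pulled back to `k(x,y)[z]`, where uniqueness is known; domination
    -- supplies its triviality on constants.
    have h : μ.comap (DefSeq.ofTower k) = ν₀ := by
      refine huniq _ (fun a ha => ?_) (fun i => ?_) fun i hi => ?_
      · rw [← hdom.valuation_C ha, ← DefSeq.ofTower_toTower]; rfl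
      · rw [← hμP i, ← DefSeq.ofTower_toTower]; rfl
      · rw [← hμQ i hi, ← DefSeq.ofTower_toTower]; rfl
    refine DefSeq.fraction_valuation_ext (MvPolynomial (Fin 3) k) fun f => ?_
    rw [hν', ← h, ← DefSeq.ofTower_toTower]
    rfl
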